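/- Let $M$ be a smooth (Hausdorff) oriented $4$-manifold with a semi-Riemannian metric $g$ (a smooth nondegenerate symmetric $2$-tensor) with Levi-Civita connection $\nabla$, and let $k,t$ be smooth vector fields on $M$ and $\tau,\ell$ smooth functions on $M$. Put $\mathcal V=\mathrm{span}(k,t)$, $\mathcal H=\mathcal V^{\perp}$, and let $\pi:TM\to\mathcal H$ be the projection along $\mathcal V$. Assume that $k,t$ are linearly independent at every point and that $g|_{\mathcal H}$ is positive definite. Then $TM=\mathcal V\oplus\mathcal H$; orient $\mathcal V$ by $(k,t)$ and $\mathcal H$ so that $\mathcal V\oplus\mathcal H$ carries the orientation of $M$. Let $J=J_{g,k,t}$ be the almost complex structure with $Jk=t$, $Jt=-k$, such that $J|_{\mathcal H}$ is the unique $g$-isometry of $\mathcal H$ with square $-1$ that respects the orientation of $\mathcal H$ (i.e. $(x,Jx)$ is positively oriented for $0\ne x\in\mathcal H$). For a vector field $X$ with values in $\mathcal V$ let $\nabla^oX:\mathcal H\to\mathcal H$ (the relative shear operator) be the trace-free symmetric part of $\pi\circ\nabla X|_{\mathcal H}$. Assume that $(M,g)$ is admissible with vector fields $k,t$, that is, in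 addition: 1. $[k,\Gamma(\mathcal H)]\subset\Gamma(\mathcal H)$ and $[t,\Gamma(\mathcal H)]\subset\Gamma(\mathcal H)$, and $J\,\nabla^ok=\nabla^o(Jk)$ on $\mathcal H$; 2. $t=\ell\,\nabla\tau$; 3. $\nabla(g(k,t))$ and $\nabla(g(k,k))$ are sections of $\mathcal V$. Let $\iota=g(\nabla_yk,x)-g(\nabla_xk,y)$, for any oriented orthonormal frame $(x,y)$ of $\mathcal H$, be the (signed) relative twist function of $k$, let $G=g(k,k)g(t,t)-g(k,t)^2$, and let $k^\flat=g(k,\cdot)$. Let $f$ be a real function that is smooth on the range of $\tau$, and put $$\omega=d\big(f(\tau)\,k^\flat\big),\qquad g_K=\omega(\cdot,J\cdot).$$ Then $\omega$ is $J$-invariant on $M$. Let $U$ be the set of points of $M$ at which $$f\iota<0\qquad\text{and}\qquad \frac{f'G}{\ell}-f\,dk^\flat(k,t)<0,$$ where $f$ and its derivative $f'$ are evaluated at $\tau$ (and $\ell$ has no zeros, since $t$ has none). Then $U$ is open and, on $U$, $g_K$ is a Kähler metric with respect to the complex structure $J$, with Kähler form the exact form $\omega$: $g_K$ is a smooth Riemannian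 metric, $J$ is smooth with $J^2=-1$ and vanishing Nijenhuis tensor, $g_K(J\cdot,J\cdot)=g_K$, $\omega=g_K(J\cdot,\cdot)$, and $d\omega=0$. -/

import Mathlib

open Set Filter Topology Bundle Manifold VectorField
open scoped ContDiff

attribute [local instance 10000] chartedSpaceSelf

/-- The model space `ℝ⁴`. -/
abbrev R4 : Type := EuclideanSpace ℝ (Fin 4)

/-- The tangent space of a 4-manifold at `p`. -/
abbrev Tan {M : Type*} [TopologicalSpace M] [ChartedSpace R4 M] (p : M) : Type :=
  TangentSpace (𝓡 4) p

/-- (Not necessarily smooth) vector fields on a 4-manifold. -/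
abbrev VField (M : Type*) [TopologicalSpace M] [ChartedSpace R4 M] : Type _ :=
  (p : M) → Tan p

/-- (Not necessarily smooth) differential `n`-forms on a 4-manifold. -/
abbrev DForm (M : Type*) [TopologicalSpace M] [ChartedSpace R4 M] (n : ℕ) : Type _ :=
  (p : M) → (Tan p) [⋀^Fin n]→L[ℝ] ℝ

/-- Smoothness of a vector field on a set. -/
def SmoothFieldOn {M : Type*} [TopologicalSpace M] [ChartedSpace R4 M]
    [IsManifold (𝓡 4) ∞ M] (X : VField M) (U : Set M) : Prop :=
  ContMDiffOn (𝓡 4) (𝓡 4).tangent ∞ (fun p => (⟨p, X p⟩ : TangentBundle (𝓡 4) M)) U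

/-- Smoothness of a field of bilinear forms on a set. -/
def SmoothBilinOn {M : Type*} [TopologicalSpace M] [ChartedSpace R4 M]
    [IsManifold (𝓡 4) ∞ M] (b : (p : M) → Tan p →L[ℝ] Tan p →L[ℝ] ℝ) (U : Set M) : Prop :=
  ContMDiffOn (𝓡 4) ((𝓡 4).prod 𝓘(ℝ, R4 →L[ℝ] R4 →L[ℝ] ℝ)) ∞
    (fun p => TotalSpace.mk' (R4 →L[ℝ] R4 →L[ℝ] ℝ)
      (E := fun p : M => Tan p →L[ℝ] Tan p →L[ℝ] ℝ) p (b p)) U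

/-- Smoothness of a field of endomorphisms of the tangent spaces on a set. -/
def SmoothEndoOn {M : Type*} [TopologicalSpace M] [ChartedSpace R4 M]
    [IsManifold (𝓡 4) ∞ M] (J : (p : M) → Tan p →L[ℝ] Tan p) (U : Set M) : Prop :=
  ContMDiffOn (𝓡 4) ((𝓡 4).prod 𝓘(ℝ, R4 →L[ℝ] R4)) ∞
    (fun p => TotalSpace.mk' (R4 →L[ℝ] R4) (E := fun p : M => Tan p →L[ℝ] Tan p) p (J p)) U

/-- A semi-Riemannian metric: a smooth field of nondegenerate symmetric bilinear forms
(its index is then automatically constant on connected components). -/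
structure SemiRiemannianMetric (M : Type*) [TopologicalSpace M] [ChartedSpace R4 M]
    [IsManifold (𝓡 4) ∞ M] where
  val : (p : M) → Tan p →L[ℝ] Tan p →L[ℝ] ℝ
  symm : ∀ (p : M) (u v : Tan p), val p u v = val p v u
  nondegenerate : ∀ (p : M) (u : Tan p), (∀ v : Tan p, val p u v = 0) → u = 0
  smooth : SmoothBilinOn val univ

noncomputable section

/-- The derivative at `q` of the chart centred at `p`. -/
def toChart {M : Type*} [TopologicalSpace M] [ChartedSpace R4 M] (p q : M) : Tan q →L[ℝ] R4 :=
  mfderiv (𝓡 4) 𝓘(ℝ, R4) (extChartAt (𝓡 4) p) q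

/-- The derivative at `y` of the inverse of the chart centred at `p`. -/
def fromChart {M : Type*} [TopologicalSpace M] [ChartedSpace R4 M] (p : M) (y : R4) :
    R4 →L[ℝ] Tan ((extChartAt (𝓡 4) p).symm y) :=
  mfderiv 𝓘(ℝ, R4) (𝓡 4) (extChartAt (𝓡 4) p).symm y

/-- An orientation of a 4-manifold: a choice of orientation of each tangent space which is
locally constant when read in charts. -/
structure MOrientation (M : Type*) [TopologicalSpace M] [ChartedSpace R4 M] where
  val : (p : M) → Orientation ℝ (Tan p) (Fin 4)
  locally_constant : ∀ p : M, ∃ o : Orientation ℝ R4 (Fin 4), ∀ᶠ q in 𝓝 p,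
    ∃ A : Tan q ≃ₗ[ℝ] R4, (∀ v : Tan q, A v = toChart p q v) ∧
      Orientation.map (Fin 4) A (val q) = o

/-- `e` is a positively oriented basis of the tangent space at `p`. -/
def MOrientation.IsPositive {M : Type*} [TopologicalSpace M] [ChartedSpace R4 M]
    (o : MOrientation M) (p : M) (e : Fin 4 → Tan p) : Prop :=
  ∃ b : Module.Basis (Fin 4) ℝ (Tan p), (∀ i, b i = e i) ∧ b.orientation = o.val p

/-- The exterior derivative of a differential form, computed at `p` in the chart centred at `p`
(normalised so that `dθ(X, Y) = X(θ(Y)) - Y(θ(X)) - θ([X, Y])` for one-forms `θ`). -/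
def mextDeriv {M : Type*} [TopologicalSpace M] [ChartedSpace R4 M] {n : ℕ}
    (η : DForm M n) : DForm M (n + 1) := fun p =>
  (extDeriv (fun y : R4 =>
    (η ((extChartAt (𝓡 4) p).symm y)).compContinuousLinearMap (fromChart p y))
    (extChartAt (𝓡 4) p p)).compContinuousLinearMap (toChart p p)

/-- A field of linear functionals as a differential one-form. -/
def oneForm {M : Type*} [TopologicalSpace M] [ChartedSpace R4 M]
    (θ : (p : M) → Tan p →L[ℝ] ℝ) : DForm M 1 := fun p =>
  ContinuousAlternatingMap.ofSubsingleton ℝ (Tan p) ℝ (0 : Fin 1) (θ p)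

/-- The Levi-Civita covariant derivative `v ↦ ∇_v X` at `y`, for a metric `g` and a vector field
`X` on (an open subset of) a vector space: `∇_v X = D_v X + Γ(v, X)` with the Christoffel symbols
`2 g(Γ(v, X), z) = (D_v g)(X, z) + (D_X g)(v, z) - (D_z g)(v, X)`. -/
def flatNabla {E : Type*} [NormedAddCommGroup E] [NormedSpace ℝ E]
    (g : E → E →L[ℝ] E →L[ℝ] ℝ) (X : E → E) (y : E) : E →L[ℝ] E :=
  let L : E →L[ℝ] E →L[ℝ] ℝ := (fderiv ℝ g y).flip (X y)
  let R : E →L[ℝ] E →L[ℝ] ℝ := fderiv ℝ g y (X y)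
  fderiv ℝ X y + (1 / 2 : ℝ) • ((g y).inverse ∘L (L + R - L.flip))

/-- The adjoint of `A` with respect to a bilinear form `b`: `b(A* u, v) = b(u, A v)`. -/
def bilinAdj {E : Type*} [NormedAddCommGroup E] [NormedSpace ℝ E]
    (b : E →L[ℝ] E →L[ℝ] ℝ) (A : E →L[ℝ] E) : E →L[ℝ] E :=
  b.inverse ∘L (b.flip ∘L A).flip

/-- The bilinear form `(u, v) ↦ η(u, J v)` of a two-form `η` and an endomorphism `J`. -/
def twistedBilin {E : Type*} [NormedAddCommGroup E] [NormedSpace ℝ E]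
    (η : E [⋀^Fin 2]→L[ℝ] ℝ) (J : E →L[ℝ] E) : E →L[ℝ] E →L[ℝ] ℝ :=
  (((ContinuousAlternatingMap.ofSubsingletonLIE (𝕜 := ℝ) (E := E) (F := ℝ) (0 : Fin 1)).symm :
      (E [⋀^Fin 1]→L[ℝ] ℝ) →L[ℝ] (E →L[ℝ] ℝ)) ∘L η.curryLeft).bilinearComp
    (ContinuousLinearMap.id ℝ E) J

theorem twistedBilin_apply {E : Type*} [NormedAddCommGroup E] [NormedSpace ℝ E]
    (η : E [⋀^Fin 2]→L[ℝ] ℝ) (J : E →L[ℝ] E) (u v : E) :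
    twistedBilin η J u v = η ![u, J v] := by
  simp only [twistedBilin, ContinuousLinearMap.bilinearComp_apply]
  refine congrArg η (funext fun i => ?_)
  fin_cases i <;> rfl


/-- A pair `(x, y)` that is `B`-orthonormal, orthogonal to `k, t`, and completes `k, t` to a
positively oriented basis. -/
def OFrame {E : Type*} [AddCommGroup E] [Module ℝ E]
    (B : E →ₗ[ℝ] E →ₗ[ℝ] ℝ) (o : Orientation ℝ E (Fin 4)) (k t x y : E) : Prop :=
  (B k x = 0 ∧ B t x = 0) ∧ (B k y = 0 ∧ B t y = 0) ∧ B x x = 1 ∧ B y y = 1 ∧ B x y = 0 ∧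
    ∃ b : Module.Basis (Fin 4) ℝ E, (∀ i, b i = ![k, t, x, y] i) ∧ b.orientation = o

theorem li_frame {E : Type*} [AddCommGroup E] [Module ℝ E]
    (B : E →ₗ[ℝ] E →ₗ[ℝ] ℝ) (k t x y : E)
    (hs : ∀ u v, B u v = B v u) (hli : LinearIndependent ℝ ![k, t])
    (hpos : ∀ v, B k v = 0 → B t v = 0 → v ≠ 0 → 0 < B v v)
    (hx : B k x = 0 ∧ B t x = 0) (hy : B k y = 0 ∧ B t y = 0)
    (hx0 : x ≠ 0) (hy0 : y ≠ 0) (hxy : B x y = 0) :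
    LinearIndependent ℝ ![k, t, x, y] := by
  rw [Fintype.linearIndependent_iff]
  intro c hc
  simp only [Fin.sum_univ_four, Matrix.cons_val] at hc
  have e1 := congrArg (fun v => B v x) hc
  have e2 := congrArg (fun v => B v y) hc
  simp [hx.1, hx.2, hy.1, hy.2, hxy, hs y x] at e1 e2
  have px := (hpos x hx.1 hx.2 hx0).ne'
  have py := (hpos y hy.1 hy.2 hy0).ne'
  have c2 : c 2 = 0 := by tauto
  have c3 : c 3 = 0 := by tauto
  rw [c2, c3] at hc
  have h2 := (LinearIndependent.pair_iff.mp hli) (c 0) (c 1) (by simpa using hc)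
  intro i
  fin_cases i
  · exact h2.1
  · exact h2.2
  · exact c2
  · exact c3

theorem span_frame {E : Type*} [AddCommGroup E] [Module ℝ E]
    (B : E →ₗ[ℝ] E →ₗ[ℝ] ℝ) (k t x y : E)
    (hs : ∀ u v, B u v = B v u)
    (hpos : ∀ v, B k v = 0 → B t v = 0 → v ≠ 0 → 0 < B v v)
    (o : Orientation ℝ E (Fin 4)) (h : OFrame B o k t x y) (v : E)
    (hv : B k v = 0 ∧ B t v = 0) : v = B v x • x + B v y • y := by
  obtain ⟨hx, hy, hxx, hyy, hxy, b, hb, -⟩ := h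
  have hrep := b.sum_repr v
  simp only [Fin.sum_univ_four, hb, Matrix.cons_val] at hrep
  set c := b.repr v
  have hvx : B v x = c 2 := by
    rw [← hrep]; simp [hx.1, hx.2, hxx, hs y x, hxy]
  have hvy : B v y = c 3 := by
    rw [← hrep]; simp [hy.1, hy.2, hyy, hxy]
  have hw : v - (c 2 • x + c 3 • y) = c 0 • k + c 1 • t := by
    nth_rw 1 [← hrep]; module
  by_contra hne
  rw [hvx, hvy] at hne
  have := hpos (v - (c 2 • x + c 3 • y)) (by simp [hv.1, hx.1, hy.1]) (by simp [hv.2, hx.2, hy.2])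
    (sub_ne_zero.mpr hne)
  nth_rw 1 [hw] at this
  simp [hv.1, hv.2, hx.1, hx.2, hy.1, hy.2] at this

theorem det_frame {E : Type*} [AddCommGroup E] [Module ℝ E]
    (k t x y : E) (b : Module.Basis (Fin 4) ℝ E)
    (hb : ∀ i, b i = ![k, t, x, y] i) (a c d e : ℝ) :
    b.det ![k, t, a • x + c • y, d • x + e • y] = a * e - c * d := by
  have h0 : b.repr k = Finsupp.single 0 1 := by
    rw [← b.repr_self 0, hb]; rfl
  have h1 : b.repr t = Finsupp.single 1 1 := by
    rw [← b.repr_self 1, hb]; rfl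
  have h2 : b.repr x = Finsupp.single 2 1 := by
    rw [← b.repr_self 2, hb]; rfl
  have h3 : b.repr y = Finsupp.single 3 1 := by
    rw [← b.repr_self 3, hb]; rfl
  rw [Module.Basis.det_apply]
  have : b.toMatrix ![k, t, a • x + c • y, d • x + e • y] =
      !![1, 0, 0, 0; 0, 1, 0, 0; 0, 0, a, d; 0, 0, c, e] := by
    ext i j
    fin_cases i <;> fin_cases j <;>
      simp [Module.Basis.toMatrix_apply, h0, h1, h2, h3]
  rw [this]
  simp [Matrix.det_succ_row_zero, Fin.sum_univ_succ]
  try ring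

theorem exists_oFrame {E : Type*} [AddCommGroup E] [Module ℝ E]
    (B : E →ₗ[ℝ] E →ₗ[ℝ] ℝ) (k t : E) (hdim : Module.finrank ℝ E = 4)
    (hs : ∀ u v, B u v = B v u) (hli : LinearIndependent ℝ ![k, t])
    (hpos : ∀ v, B k v = 0 → B t v = 0 → v ≠ 0 → 0 < B v v)
    (o : Orientation ℝ E (Fin 4)) : ∃ x y, OFrame B o k t x y := by
  have : FiniteDimensional ℝ E := Module.finite_of_finrank_pos (by omega)
  have unit : ∀ v, B k v = 0 → B t v = 0 → v ≠ 0 → ∃ c : ℝ, B (c • v) (c • v) = 1 := by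
    intro v h1 h2 h3
    have := hpos v h1 h2 h3
    refine ⟨(Real.sqrt (B v v))⁻¹, ?_⟩
    have h4 := Real.mul_self_sqrt this.le
    have h5 := (Real.sqrt_pos.mpr this).ne'
    simp only [map_smul, LinearMap.smul_apply, smul_eq_mul]
    field_simp
    rw [sq, h4]
  have key : ∀ z : E, ∃ v, v ≠ 0 ∧ B k v = 0 ∧ B t v = 0 ∧ B z v = 0 := by
    intro z
    have hk : LinearMap.ker (LinearMap.pi ![B k, B t, B z]) ≠ ⊥ :=
      LinearMap.ker_ne_bot_of_finrank_lt (by simp [hdim])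
    obtain ⟨v, hv, hv0⟩ := Submodule.exists_mem_ne_zero_of_ne_bot hk
    have hv' := congrFun (LinearMap.mem_ker.mp hv)
    exact ⟨v, hv0, hv' 0, hv' 1, hv' 2⟩
  obtain ⟨x0, hx0, hx1, hx2, -⟩ := key 0
  obtain ⟨a, ha⟩ := unit x0 hx1 hx2 hx0
  obtain ⟨y0, hy0, hy1, hy2, hy3⟩ := key (a • x0)
  obtain ⟨c, hc⟩ := unit y0 hy1 hy2 hy0
  have hx : B k (a • x0) = 0 ∧ B t (a • x0) = 0 := by simp [hx1, hx2]
  have hy : B k (c • y0) = 0 ∧ B t (c • y0) = 0 := by simp [hy1, hy2]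
  have hxy : B (a • x0) (c • y0) = 0 := by rw [map_smul, hy3, smul_zero]
  generalize a • x0 = x at *
  generalize c • y0 = y at *
  have hxn : x ≠ 0 := by rintro rfl; simp at ha
  have hyn : y ≠ 0 := by rintro rfl; simp at hc
  have hl := li_frame B k t x y hs hli hpos hx hy hxn hyn hxy
  let b := basisOfLinearIndependentOfCardEqFinrank hl (by simp [hdim])
  have hb : ∀ i, b i = ![k, t, x, y] i := fun i => by simp [b]
  by_cases ho : b.orientation = o
  · exact ⟨x, y, hx, hy, ha, hc, hxy, b, hb, ho⟩
  · have hl' := li_frame B k t x (-y) hs hli hpos hx (by simp [hy]) hxn (by simpa using hyn)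
      (by simp [hxy])
    let b' := basisOfLinearIndependentOfCardEqFinrank hl' (by simp [hdim])
    have hb' : ∀ i, b' i = ![k, t, x, -y] i := fun i => by simp [b']
    refine ⟨x, -y, hx, by simp [hy], ha, by simp [hc], by simp [hxy], b', hb', ?_⟩
    have hd : b.det b' = -1 := by
      have := det_frame k t x y b hb 1 0 0 (-1)
      rw [show (b' : Fin 4 → E) = ![k, t, x, -y] from funext hb']
      simpa using this
    have hne : b.orientation ≠ b'.orientation := by
      rw [Ne, Module.Basis.orientation_eq_iff_det_pos, hd]; norm_num
    have hne' : b.orientation = -b'.orientation := by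
      rcases Module.Basis.orientation_eq_or_eq_neg b b'.orientation with h | h
      · exact absurd h.symm hne
      · rw [h]; exact (neg_neg b.orientation).symm
    rcases Module.Basis.orientation_eq_or_eq_neg b' o with h | h
    · exact h.symm
    · exact absurd (hne'.trans h.symm) ho

theorem j_frame {E : Type*} [AddCommGroup E] [Module ℝ E]
    (B : E →ₗ[ℝ] E →ₗ[ℝ] ℝ) (k t x y : E)
    (hs : ∀ u v, B u v = B v u)
    (hpos : ∀ v, B k v = 0 → B t v = 0 → v ≠ 0 → 0 < B v v)
    (o : Orientation ℝ E (Fin 4)) (h : OFrame B o k t x y) (J : E → E)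
    (hH : ∀ v, B k v = 0 ∧ B t v = 0 → B k (J v) = 0 ∧ B t (J v) = 0)
    (hsq : ∀ v, B k v = 0 ∧ B t v = 0 → J (J v) = -v)
    (hiso : ∀ u, B k u = 0 ∧ B t u = 0 → ∀ v, B k v = 0 ∧ B t v = 0 → B (J u) (J v) = B u v)
    (hor : ∀ v, B k v = 0 ∧ B t v = 0 → v ≠ 0 →
      ∃ b : Module.Basis (Fin 4) ℝ E, (∀ i, b i = ![k, t, v, J v] i) ∧ b.orientation = o) :
    J x = y := by
  have hsp := span_frame B k t x y hs hpos o h (J x) (hH x h.1)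
  obtain ⟨hx, hy, hxx, hyy, hxy, b, hb, hbo⟩ := h
  have h1 := hiso x hx (J x) (hH x hx)
  rw [hsq x hx, map_neg, hs x (J x)] at h1
  have h2 : B (J x) x = 0 := by linarith
  rw [h2, zero_smul, zero_add] at hsp
  set β := B (J x) y
  have h3 := hiso x hx x hx
  rw [hsp, hxx] at h3
  simp [hyy] at h3
  have hx0 : x ≠ 0 := by rintro rfl; simp at hxx
  obtain ⟨b', hb', hbo'⟩ := hor x hx hx0
  have hd := (Module.Basis.orientation_eq_iff_det_pos b b').mp (hbo.trans hbo'.symm)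
  rw [show (b' : Fin 4 → E) = ![k, t, x, J x] from funext hb', hsp] at hd
  have hd2 := det_frame k t x y b hb 1 0 0 β
  simp at hd2
  rw [hd2] at hd
  have : β = 1 := by nlinarith
  rw [hsp, this, one_smul]

theorem exists_j {E : Type*} [AddCommGroup E] [Module ℝ E]
    (B : E →ₗ[ℝ] E →ₗ[ℝ] ℝ) (k t : E) (hdim : Module.finrank ℝ E = 4)
    (hs : ∀ u v, B u v = B v u) (hli : LinearIndependent ℝ ![k, t])
    (hpos : ∀ v, B k v = 0 → B t v = 0 → v ≠ 0 → 0 < B v v)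
    (o : Orientation ℝ E (Fin 4)) : ∃ J : E →ₗ[ℝ] E, J k = t ∧ J t = -k ∧
    (∀ v, B k v = 0 ∧ B t v = 0 → B k (J v) = 0 ∧ B t (J v) = 0) ∧
    (∀ v, B k v = 0 ∧ B t v = 0 → J (J v) = -v) ∧
    (∀ u, B k u = 0 ∧ B t u = 0 → ∀ v, B k v = 0 ∧ B t v = 0 → B (J u) (J v) = B u v) ∧
    (∀ v, B k v = 0 ∧ B t v = 0 → v ≠ 0 →
      ∃ b : Module.Basis (Fin 4) ℝ E, (∀ i, b i = ![k, t, v, J v] i) ∧ b.orientation = o) := by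
  obtain ⟨x, y, h⟩ := exists_oFrame B k t hdim hs hli hpos o
  have hsp := span_frame B k t x y hs hpos o h
  obtain ⟨hx, hy, hxx, hyy, hxy, b, hb, hbo⟩ := h
  let J : E →ₗ[ℝ] E := b.constr ℝ ![t, -k, y, -x]
  have hJ : ∀ i, J (![k, t, x, y] i) = ![t, -k, y, -x] i := fun i => by
    rw [← hb, Module.Basis.constr_basis]
  have hJk : J k = t := hJ 0
  have hJt : J t = -k := hJ 1
  have hJx : J x = y := hJ 2
  have hJy : J y = -x := hJ 3
  have hJv : ∀ v, B k v = 0 ∧ B t v = 0 → J v = (-B v y) • x + B v x • y := fun v hv => by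
    nth_rw 1 [hsp v hv]
    simp only [map_add, map_smul, hJx, hJy]
    module
  have hH : ∀ v, B k v = 0 ∧ B t v = 0 → B k (J v) = 0 ∧ B t (J v) = 0 := fun v hv => by
    rw [hJv v hv]; simp [hx.1, hx.2, hy.1, hy.2]
  have hyx : B y x = 0 := by rw [hs, hxy]
  refine ⟨J, hJk, hJt, hH, ?_, ?_, ?_⟩
  · intro v hv
    rw [hJv (J v) (hH v hv), hJv v hv]
    conv_rhs => rw [hsp v hv]
    simp [hxx, hyy, hxy, hyx]
    module
  · intro u hu v hv
    rw [hJv u hu, hJv v hv]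
    conv_rhs => rw [hsp u hu, hsp v hv]
    simp [hxx, hyy, hxy, hyx]
    ring
  · intro v hv hv0
    have e1 : B v v = B v x * B v x + B v y * B v y := by
      nth_rw 2 [hsp v hv]; simp
    have hp := hpos v hv.1 hv.2 hv0
    have hvJ : B v (J v) = 0 := by rw [hJv v hv]; simp; ring
    have hJ0 : J v ≠ 0 := by
      intro h0
      have e2 : B (J v) x = -B v y := by rw [hJv v hv]; simp [hxx, hyx]
      have e3 : B (J v) y = B v x := by rw [hJv v hv]; simp [hyy, hxy]
      rw [h0] at e2 e3
      simp at e2 e3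
      rw [← e3, e2] at e1
      simp at e1
      exact hp.ne' e1
    have hl := li_frame B k t v (J v) hs hli hpos hv (hH v hv) hv0 hJ0 hvJ
    let b' := basisOfLinearIndependentOfCardEqFinrank hl (by simp [hdim])
    have hb' : ∀ i, b' i = ![k, t, v, J v] i := fun i => by simp [b']
    refine ⟨b', hb', ?_⟩
    rw [← hbo, eq_comm, Module.Basis.orientation_eq_iff_det_pos,
      show (b' : Fin 4 → E) = ![k, t, v, J v] from funext hb', hJv v hv]
    nth_rw 1 [hsp v hv]
    rw [det_frame k t x y b hb]
    linarith

theorem oFrame_unique {E : Type*} [AddCommGroup E] [Module ℝ E]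
    (B : E →ₗ[ℝ] E →ₗ[ℝ] ℝ) (k t : E) (hdim : Module.finrank ℝ E = 4)
    (hs : ∀ u v, B u v = B v u) (hli : LinearIndependent ℝ ![k, t])
    (hpos : ∀ v, B k v = 0 → B t v = 0 → v ≠ 0 → 0 < B v v)
    (o : Orientation ℝ E (Fin 4)) (x y x' y' : E) (h : OFrame B o k t x y)
    (h' : OFrame B o k t x' y') :
    ∃ a c : ℝ, a * a + c * c = 1 ∧ x' = a • x + c • y ∧ y' = (-c) • x + a • y := by
  obtain ⟨J, hk, ht, hH, hsq, hiso, hor⟩ := exists_j B k t hdim hs hli hpos o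
  have e := j_frame B k t x y hs hpos o h J hH hsq hiso hor
  have e' := j_frame B k t x' y' hs hpos o h' J hH hsq hiso hor
  have hx' := span_frame B k t x y hs hpos o h x' h'.1
  have e2 : J y = -x := by rw [← e, hsq x h.1]
  refine ⟨B x' x, B x' y, ?_, hx', ?_⟩
  · have := h'.2.2.1
    nth_rw 2 [hx'] at this
    simpa using this
  · rw [← e']
    nth_rw 1 [hx']
    simp only [map_add, map_smul, e, e2]
    module

namespace SemiRiemannianMetric

/-- The metric read in the chart centred at `p`. -/
def inChart {M : Type*} [TopologicalSpace M] [ChartedSpace R4 M] [IsManifold (𝓡 4) ∞ M]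
    (g : SemiRiemannianMetric M) (p : M) (y : R4) : R4 →L[ℝ] R4 →L[ℝ] ℝ :=
  ContinuousLinearMap.bilinearComp (E := R4) (F := R4)
    (g.val ((extChartAt (𝓡 4) p).symm y)) (fromChart p y) (fromChart p y)

/-- `∇X` for the Levi-Civita connection of `g`, as the operator `v ↦ ∇_v X` on the tangent space
at `p`, computed in the chart centred at `p`. -/
def nabla {M : Type*} [TopologicalSpace M] [ChartedSpace R4 M] [IsManifold (𝓡 4) ∞ M]
    (g : SemiRiemannianMetric M) (X : VField M) (p : M) : Tan p →L[ℝ] Tan p :=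
  (toChart p p).inverse ∘L
    flatNabla (g.inChart p) (mpullback 𝓘(ℝ, R4) (𝓡 4) (extChartAt (𝓡 4) p).symm X)
      (extChartAt (𝓡 4) p p) ∘L toChart p p

/-- The gradient of a function: `g(∇u, ·) = du`. -/
def grad {M : Type*} [TopologicalSpace M] [ChartedSpace R4 M] [IsManifold (𝓡 4) ∞ M]
    (g : SemiRiemannianMetric M) (u : M → ℝ) : VField M := fun p =>
  (g.val p).inverse (mvfderiv (𝓡 4) u p)

/-- The `g`-adjoint of an endomorphism of the tangent space: `g(A* u, v) = g(u, A v)`. -/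
def adj {M : Type*} [TopologicalSpace M] [ChartedSpace R4 M] [IsManifold (𝓡 4) ∞ M]
    (g : SemiRiemannianMetric M) (p : M) (A : Tan p →L[ℝ] Tan p) : Tan p →L[ℝ] Tan p :=
  bilinAdj (E := R4) (g.val p) A

/-- The distribution `𝒱 = span(k, t)`. -/
def vert {M : Type*} [TopologicalSpace M] [ChartedSpace R4 M]
    (k t : VField M) (p : M) : Submodule ℝ (Tan p) :=
  Submodule.span ℝ {k p, t p}

/-- The distribution `ℋ = span(k, t)^⊥`. -/
def horiz {M : Type*} [TopologicalSpace M] [ChartedSpace R4 M] [IsManifold (𝓡 4) ∞ M]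
    (g : SemiRiemannianMetric M) (k t : VField M) (p : M) : Submodule ℝ (Tan p) where
  carrier := {v | g.val p (k p) v = 0 ∧ g.val p (t p) v = 0}
  add_mem' := by
    rintro a b ⟨h1, h2⟩ ⟨h3, h4⟩
    exact ⟨by rw [map_add, h1, h3, add_zero], by rw [map_add, h2, h4, add_zero]⟩
  zero_mem' := ⟨map_zero _, map_zero _⟩
  smul_mem' := by
    rintro c a ⟨h1, h2⟩
    exact ⟨by rw [map_smul, h1, smul_zero], by rw [map_smul, h2, smul_zero]⟩

/-- `G`, the determinant of the Gram matrix of `k, t`. -/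
def gramDet {M : Type*} [TopologicalSpace M] [ChartedSpace R4 M] [IsManifold (𝓡 4) ∞ M]
    (g : SemiRiemannianMetric M) (k t : VField M) (p : M) : ℝ :=
  Matrix.det !![g.val p (k p) (k p), g.val p (k p) (t p);
                g.val p (t p) (k p), g.val p (t p) (t p)]

/-- The projection `π : TM → ℋ` along `𝒱` (by Cramer's rule for the `𝒱`-component). -/
def proj {M : Type*} [TopologicalSpace M] [ChartedSpace R4 M] [IsManifold (𝓡 4) ∞ M]
    (g : SemiRiemannianMetric M) (k t : VField M) (p : M) : Tan p →L[ℝ] Tan p :=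
  ContinuousLinearMap.id ℝ (Tan p)
    - (((g.val p (t p) (t p) / g.gramDet k t p) • g.val p (k p)
        - (g.val p (k p) (t p) / g.gramDet k t p) • g.val p (t p)).smulRight (k p))
    - (((g.val p (k p) (k p) / g.gramDet k t p) • g.val p (t p)
        - (g.val p (k p) (t p) / g.gramDet k t p) • g.val p (k p)).smulRight (t p))

/-- The relative shear operator of `X`: the trace-free symmetric part of `π ∘ ∇X|_ℋ`, as an operator
on `ℋ` (extended by zero on `𝒱`). -/
def shear {M : Type*} [TopologicalSpace M] [ChartedSpace R4 M] [IsManifold (𝓡 4) ∞ M]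
    (g : SemiRiemannianMetric M) (k t X : VField M) (p : M) : Tan p →L[ℝ] Tan p :=
  let P : Tan p →L[ℝ] Tan p := g.proj k t p
  let A : Tan p →L[ℝ] Tan p := P ∘L g.nabla X p ∘L P
  (1 / 2 : ℝ) • (A + g.adj p A)
    - ((1 / 2 : ℝ) * LinearMap.trace ℝ (Tan p) (A : Tan p →ₗ[ℝ] Tan p)) • P

/-- `(x, y)` is an oriented orthonormal frame of `ℋ` at `p`; the orientation of `ℋ` is the one for
which `TM = 𝒱 ⊕ ℋ` is oriented, `𝒱` being oriented by `(k, t)`. -/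
def IsOrientedFrame {M : Type*} [TopologicalSpace M] [ChartedSpace R4 M] [IsManifold (𝓡 4) ∞ M]
    (g : SemiRiemannianMetric M) (o : MOrientation M) (k t : VField M) (p : M)
    (x y : Tan p) : Prop :=
  x ∈ g.horiz k t p ∧ y ∈ g.horiz k t p ∧
    g.val p x x = 1 ∧ g.val p y y = 1 ∧ g.val p x y = 0 ∧ o.IsPositive p ![k p, t p, x, y]

/-- The signed relative twist function `ι` of `k`:
`ι = g(∇_y k, x) - g(∇_x k, y)` for any oriented orthonormal frame `(x, y)` of `ℋ`. -/
def twist {M : Type*} [TopologicalSpace M] [ChartedSpace R4 M] [IsManifold (𝓡 4) ∞ M]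
    (g : SemiRiemannianMetric M) (o : MOrientation M) (k t : VField M) (p : M) : ℝ :=
  let F : Tan p × Tan p := Classical.epsilon fun F => g.IsOrientedFrame o k t p F.1 F.2
  g.val p (g.nabla k p F.2) F.1 - g.val p (g.nabla k p F.1) F.2

/-- The defining properties of the almost complex structure `J_{g,k,t}` at `p`: it sends `k` to `t`
and `t` to `-k`, and on `ℋ` it is the isometry with square `-1` respecting the orientation. -/
structure IsJAt {M : Type*} [TopologicalSpace M] [ChartedSpace R4 M] [IsManifold (𝓡 4) ∞ M]
    (g : SemiRiemannianMetric M) (o : MOrientation M) (k t : VField M) (p : M)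
    (J : Tan p →L[ℝ] Tan p) : Prop where
  map_k : J (k p) = t p
  map_t : J (t p) = -k p
  map_horiz : ∀ x ∈ g.horiz k t p, J x ∈ g.horiz k t p
  sq_horiz : ∀ x ∈ g.horiz k t p, J (J x) = -x
  isometry : ∀ x ∈ g.horiz k t p, ∀ y ∈ g.horiz k t p, g.val p (J x) (J y) = g.val p x y
  oriented : ∀ x ∈ g.horiz k t p, x ≠ 0 → o.IsPositive p ![k p, t p, x, J x]

/-- The almost complex structure `J_{g,k,t}`, the unique endomorphism with the properties `IsJAt`
(see `existsUnique_isJAt`). -/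
def acs {M : Type*} [TopologicalSpace M] [ChartedSpace R4 M] [IsManifold (𝓡 4) ∞ M]
    (g : SemiRiemannianMetric M) (o : MOrientation M) (k t : VField M) (p : M) :
    Tan p →L[ℝ] Tan p :=
  Classical.epsilon fun J => g.IsJAt o k t p J

/-- `g` at `p` as a bilinear form. -/
def bil {M : Type*} [TopologicalSpace M] [ChartedSpace R4 M] [IsManifold (𝓡 4) ∞ M]
    (g : SemiRiemannianMetric M) (p : M) : Tan p →ₗ[ℝ] Tan p →ₗ[ℝ] ℝ :=
  (ContinuousLinearMap.coeLM ℝ) ∘ₗ (g.val p : Tan p →ₗ[ℝ] Tan p →L[ℝ] ℝ)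

/-- Oriented orthonormal frames of `ℋ` exist, so that the choice in `twist` is a genuine one. -/
theorem exists_isOrientedFrame {M : Type*} [TopologicalSpace M] [ChartedSpace R4 M]
    [IsManifold (𝓡 4) ∞ M] (g : SemiRiemannianMetric M) (o : MOrientation M) (k t : VField M)
    (p : M) (hli : LinearIndependent ℝ ![k p, t p])
    (hpos : ∀ x ∈ g.horiz k t p, x ≠ 0 → 0 < g.val p x x) :
    ∃ x y : Tan p, g.IsOrientedFrame o k t p x y := by
  obtain ⟨x, y, hx, hy, h⟩ := exists_oFrame (g.bil p) (k p) (t p)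
    (finrank_euclideanSpace_fin (𝕜 := ℝ) (n := 4)) (g.symm p) hli
    (fun v h1 h2 h3 => hpos v ⟨h1, h2⟩ h3) (o.val p)
  exact ⟨x, y, hx, hy, h⟩

/-- The twist function does not depend on the oriented orthonormal frame. -/
theorem twist_eq {M : Type*} [TopologicalSpace M] [ChartedSpace R4 M]
    [IsManifold (𝓡 4) ∞ M] (g : SemiRiemannianMetric M) (o : MOrientation M) (k t : VField M)
    (p : M) (hli : LinearIndependent ℝ ![k p, t p])
    (hpos : ∀ x ∈ g.horiz k t p, x ≠ 0 → 0 < g.val p x x)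
    (x y : Tan p) (h : g.IsOrientedFrame o k t p x y) :
    g.twist o k t p = g.val p (g.nabla k p y) x - g.val p (g.nabla k p x) y := by
  have hF : ∃ F : Tan p × Tan p, g.IsOrientedFrame o k t p F.1 F.2 := ⟨(x, y), h⟩
  have hF' := Classical.epsilon_spec hF
  obtain ⟨a, c, h1, h2, h3⟩ := oFrame_unique (g.bil p) (k p) (t p)
    (finrank_euclideanSpace_fin (𝕜 := ℝ) (n := 4)) (g.symm p) hli
    (fun v h1 h2 h3 => hpos v ⟨h1, h2⟩ h3) (o.val p) x y _ _ h hF'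
  unfold twist
  dsimp only
  rw [h2, h3]
  simp only [map_add, map_smul, add_apply, smul_apply,
    smul_eq_mul]
  linear_combination (g.val p (g.nabla k p y) x - g.val p (g.nabla k p x) y) * h1

theorem finiteDimensional_tan {M : Type*} [TopologicalSpace M] [ChartedSpace R4 M] (p : M) :
    FiniteDimensional ℝ (Tan p) :=
  inferInstanceAs (FiniteDimensional ℝ R4)

/-- `J_{g,k,t}` exists and is unique. -/
theorem existsUnique_isJAt {M : Type*} [TopologicalSpace M] [ChartedSpace R4 M]
    [IsManifold (𝓡 4) ∞ M] (g : SemiRiemannianMetric M) (o : MOrientation M) (k t : VField M)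
    (p : M) (hli : LinearIndependent ℝ ![k p, t p])
    (hpos : ∀ x ∈ g.horiz k t p, x ≠ 0 → 0 < g.val p x x) :
    ∃! J : Tan p →L[ℝ] Tan p, g.IsJAt o k t p J := by
  have hpos' : ∀ v, g.bil p (k p) v = 0 → g.bil p (t p) v = 0 → v ≠ 0 → 0 < g.bil p v v :=
    fun v h1 h2 h3 => hpos v ⟨h1, h2⟩ h3
  obtain ⟨J, hk, ht, hH, hsq, hiso, hor⟩ := exists_j (g.bil p) (k p) (t p)
    (finrank_euclideanSpace_fin (𝕜 := ℝ) (n := 4)) (g.symm p) hli hpos' (o.val p)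
  have := finiteDimensional_tan p
  have : T2Space (Tan p) := inferInstanceAs (T2Space R4)
  let Jc : Tan p →L[ℝ] Tan p :=
    LinearMap.toContinuousLinearMap J
  refine ⟨Jc, ⟨hk, ht, hH, hsq, hiso, hor⟩, ?_⟩
  intro J' h'
  obtain ⟨x, y, h⟩ := exists_oFrame (g.bil p) (k p) (t p)
    (finrank_euclideanSpace_fin (𝕜 := ℝ) (n := 4)) (g.symm p) hli hpos' (o.val p)
  have e := j_frame (g.bil p) _ _ x y (g.symm p) hpos' (o.val p) h J hH hsq hiso hor
  have e' := j_frame (g.bil p) _ _ x y (g.symm p) hpos' (o.val p) h J'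
    h'.map_horiz h'.sq_horiz h'.isometry h'.oriented
  have e2 : J y = -x := by rw [← e, hsq x h.1]
  have e2' : J' y = -x := by rw [← e', h'.sq_horiz x h.1]
  obtain ⟨b, hb, -⟩ := h.2.2.2.2.2
  have key : (J' : Tan p →ₗ[ℝ] Tan p) = J := b.ext fun i => by
    rw [hb]
    fin_cases i
    · exact h'.map_k.trans hk.symm
    · exact h'.map_t.trans ht.symm
    · exact e'.trans e.symm
    · exact e2'.trans e2.symm
  ext v : 1
  exact LinearMap.congr_fun key v

/-- `(M, g)`, oriented by `o`, is admissible with vector fields `k` and `t = ℓ ∇τ`. -/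
structure IsAdmissible {M : Type*} [TopologicalSpace M] [ChartedSpace R4 M]
    [IsManifold (𝓡 4) ∞ M] (g : SemiRiemannianMetric M) (o : MOrientation M)
    (k t : VField M) (τ ℓ : M → ℝ) : Prop where
  smooth_k : SmoothFieldOn k univ
  smooth_t : SmoothFieldOn t univ
  linearIndependent : ∀ p, LinearIndependent ℝ ![k p, t p]
  spacelike : ∀ p, ∀ x ∈ g.horiz k t p, x ≠ 0 → 0 < g.val p x x
  bracket_k : ∀ X : VField M, SmoothFieldOn X univ → (∀ p, X p ∈ g.horiz k t p) →
    ∀ p, mlieBracket (𝓡 4) k X p ∈ g.horiz k t p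
  bracket_t : ∀ X : VField M, SmoothFieldOn X univ → (∀ p, X p ∈ g.horiz k t p) →
    ∀ p, mlieBracket (𝓡 4) t X p ∈ g.horiz k t p
  shear_eq : ∀ p, ∀ x ∈ g.horiz k t p,
    g.acs o k t p (g.shear k t k p x) = g.shear k t (fun q => g.acs o k t q (k q)) p x
  smooth_τ : ContMDiff (𝓡 4) 𝓘(ℝ, ℝ) ∞ τ
  smooth_ℓ : ContMDiff (𝓡 4) 𝓘(ℝ, ℝ) ∞ ℓ
  t_eq : ∀ p, t p = ℓ p • g.grad τ p
  grad_kt : ∀ p, g.grad (fun q => g.val q (k q) (t q)) p ∈ vert k t p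
  grad_kk : ∀ p, g.grad (fun q => g.val q (k q) (k q)) p ∈ vert k t p

/-- The one-form `u k^♭`, where `k^♭ = g(k, ·)` and `u` is a function. -/
def flatForm {M : Type*} [TopologicalSpace M] [ChartedSpace R4 M] [IsManifold (𝓡 4) ∞ M]
    (g : SemiRiemannianMetric M) (u : M → ℝ) (k : VField M) : DForm M 1 :=
  oneForm fun p => u p • g.val p (k p)

/-- The two-form `ω = d(f(τ) k^♭)`. -/
def omega {M : Type*} [TopologicalSpace M] [ChartedSpace R4 M] [IsManifold (𝓡 4) ∞ M]
    (g : SemiRiemannianMetric M) (k : VField M) (τ : M → ℝ) (f : ℝ → ℝ) : DForm M 2 :=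
  mextDeriv (g.flatForm (fun p => f (τ p)) k)

/-- The tensor `g_K = ω(·, J_{g,k,t} ·)`. -/
def gK {M : Type*} [TopologicalSpace M] [ChartedSpace R4 M] [IsManifold (𝓡 4) ∞ M]
    (g : SemiRiemannianMetric M) (o : MOrientation M) (k t : VField M) (τ : M → ℝ) (f : ℝ → ℝ)
    (p : M) : Tan p →L[ℝ] Tan p →L[ℝ] ℝ :=
  twistedBilin (E := R4) (g.omega k τ f p) (g.acs o k t p)

theorem gK_apply {M : Type*} [TopologicalSpace M] [ChartedSpace R4 M] [IsManifold (𝓡 4) ∞ M]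
    (g : SemiRiemannianMetric M) (o : MOrientation M) (k t : VField M) (τ : M → ℝ) (f : ℝ → ℝ)
    (p : M) (u v : Tan p) : g.gK o k t τ f p u v = g.omega k τ f p ![u, g.acs o k t p v] :=
  twistedBilin_apply (E := R4) (g.omega k τ f p) (g.acs o k t p) u v

/-- The region where `f ι < 0` and `f' G / ℓ - f dk^♭(k, t) < 0`, with `f` and `f'` evaluated
at `τ`. -/
def region {M : Type*} [TopologicalSpace M] [ChartedSpace R4 M] [IsManifold (𝓡 4) ∞ M]
    (g : SemiRiemannianMetric M) (o : MOrientation M) (k t : VField M) (τ ℓ : M → ℝ)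
    (f : ℝ → ℝ) : Set M :=
  {p | f (τ p) * g.twist o k t p < 0 ∧
    deriv f (τ p) * g.gramDet k t p / ℓ p
      - f (τ p) * mextDeriv (g.flatForm (fun _ => 1) k) p ![k p, t p] < 0}

end SemiRiemannianMetric

/-- The Nijenhuis tensor `N(X, Y) = [JX, JY] - J[JX, Y] - J[X, JY] - [X, Y]`. -/
def nijenhuis {M : Type*} [TopologicalSpace M] [ChartedSpace R4 M]
    (J : (p : M) → Tan p →L[ℝ] Tan p) (X Y : VField M) : VField M := fun p =>
  mlieBracket (𝓡 4) (fun q => J q (X q)) (fun q => J q (Y q)) p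
    - J p (mlieBracket (𝓡 4) (fun q => J q (X q)) Y p)
    - J p (mlieBracket (𝓡 4) X (fun q => J q (Y q)) p)
    - mlieBracket (𝓡 4) X Y p

/-- On the open set `U`, `h` is a (Riemannian) Kähler metric with complex structure `J` and Kähler
form `η = h(J ·, ·)`. -/
structure IsKahlerOn {M : Type*} [TopologicalSpace M] [ChartedSpace R4 M]
    [IsManifold (𝓡 4) ∞ M] (h : (p : M) → Tan p →L[ℝ] Tan p →L[ℝ] ℝ)
    (J : (p : M) → Tan p →L[ℝ] Tan p) (η : DForm M 2) (U : Set M) : Prop where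
  isOpen : IsOpen U
  smooth_metric : SmoothBilinOn h U
  symm : ∀ p ∈ U, ∀ u v : Tan p, h p u v = h p v u
  pos : ∀ p ∈ U, ∀ u : Tan p, u ≠ 0 → 0 < h p u u
  smooth_J : SmoothEndoOn J U
  sq_J : ∀ p ∈ U, ∀ u : Tan p, J p (J p u) = -u
  integrable : ∀ X Y : VField M, SmoothFieldOn X U → SmoothFieldOn Y U →
    ∀ p ∈ U, nijenhuis J X Y p = 0
  hermitian : ∀ p ∈ U, ∀ u v : Tan p, h p (J p u) (J p v) = h p u v
  form_eq : ∀ p ∈ U, ∀ u v : Tan p, η p ![u, v] = h p (J p u) v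
  closed : ∀ p ∈ U, mextDeriv η p = 0

end

/-! ### Reading tensors, brackets and smoothness in the chart centred at a point. -/

section Charts

set_option linter.unusedSectionVars false

variable {M : Type*} [TopologicalSpace M] [ChartedSpace R4 M] [IsManifold (𝓡 4) ∞ M]

/-! Since `t = ℓ ∇τ`, one has `dτ = t^♭/ℓ` and `ω = f' dτ ∧ k^♭ + f dk^♭`. Both `k^♭` and `dτ`
vanish on `ℋ`, so the mixed values of `ω` on `𝒱 × ℋ` come from `dk^♭` alone. For `K = k` or `K = t`
and `X` horizontal, Cartan's formula gives `dk^♭(K, X) = -X(g(k, K)) - g(k, [K, X])`; the gradient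
hypotheses kill the first term and the bracket hypotheses the second (`mextDeriv_flat_horiz`,
`omega_horiz`). Hence `ω` is block diagonal on `𝒱 ⊕ ℋ`, and on each of these planes `J` is a quarter
turn in a suitable basis, which preserves every area form. This is the `J`-invariance.

On a frame the two blocks are `ω(x, y) = -f ι` and `ω(k, t) = -(f' G/ℓ - f dk^♭(k, t))`
(`omega_frame`, `omega_vert`). So `U` is the set where `ω` is positive on both oriented planes;
there `ω(u, J u)` is a positive combination of squares (`twoForm_apply_map_pos`). Symmetry and
compatibility follow from invariance, and closedness from `d² = 0`.

For integrability, the Nijenhuis tensor `N` is `J`-antilinear in each slot, so in real dimension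
four it is determined by `N(k, x)` with `x` horizontal (`flatNijenhuis_eq_zero`). There `N(k, x) =
[t, y] - J[t, x] - J[k, y] - [k, x]` is horizontal, and its two components involve only the
trace-free symmetric parts of the Lie derivatives of `g` along `k` and `t`, that is, the shears.
They cancel exactly when `J ∇^o k = ∇^o t` (`flatNijenhuis_frame`, `nabla_frame`).

Each statement is pointwise or local, so it is checked in the chart centred at a point, with a
smooth oriented orthonormal frame of `ℋ` (`exists_frame`); that frame also yields the smoothness of
`J` and the openness of `U`. -/

theorem toChart_self (p : M) (v : Tan p) : toChart p p v = v := by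
  rw [toChart, mfderiv_extChartAt_self]; rfl

/-- The model space has no boundary, so the derivative within the range of the model is the full
derivative; this form matches the general lemmas on inverse charts. -/
theorem fromChart_eq (p : M) (y : R4) :
    fromChart p y = mfderivWithin 𝓘(ℝ, R4) (𝓡 4) (extChartAt (𝓡 4) p).symm (range (𝓡 4)) y := by
  rw [ModelWithCorners.range_eq_univ, mfderivWithin_univ]; rfl

theorem toChart_fromChart {p : M} {y : R4} (hy : y ∈ (extChartAt (𝓡 4) p).target) (v : R4) :
    toChart p ((extChartAt (𝓡 4) p).symm y) (fromChart p y v) = v := by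
  rw [fromChart_eq]
  exact DFunLike.congr_fun (mfderiv_extChartAt_comp_mfderivWithin_extChartAt_symm hy) v

theorem fromChart_toChart {p : M} {y : R4} (hy : y ∈ (extChartAt (𝓡 4) p).target)
    (v : Tan ((extChartAt (𝓡 4) p).symm y)) :
    fromChart p y (toChart p ((extChartAt (𝓡 4) p).symm y) v) = v := by
  rw [fromChart_eq]
  exact DFunLike.congr_fun (mfderivWithin_extChartAt_symm_comp_mfderiv_extChartAt hy) v

/-- The left side lives in the tangent space at `φ⁻¹(φ(p))`, which is only propositionally `p`;
hence the comparison inside `R4`. -/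
theorem fromChart_self (p : M) (v : R4) :
    (show R4 from fromChart p (extChartAt (𝓡 4) p p) v) = v := by
  rw [fromChart_eq, mfderivWithin_range_extChartAt_symm]; rfl

theorem contDiffAt_congr {E F : Type*} [NormedAddCommGroup E] [NormedSpace ℝ E]
    [NormedAddCommGroup F] [NormedSpace ℝ F] {u v : E → F} {x : E} (h : u =ᶠ[𝓝 x] v) :
    ContDiffAt ℝ ∞ u x ↔ ContDiffAt ℝ ∞ v x :=
  ⟨fun hu => hu.congr_of_eventuallyEq h.symm, fun hv => hv.congr_of_eventuallyEq h⟩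

/-- A vector field read in the chart centred at `p`. -/
noncomputable def chartField (p : M) (X : VField M) : R4 → R4 :=
  mpullback 𝓘(ℝ, R4) (𝓡 4) (extChartAt (𝓡 4) p).symm X

theorem chartField_eq (X : VField M) {p : M} {y : R4} (hy : y ∈ (extChartAt (𝓡 4) p).target) :
    chartField p X y =
      toChart p ((extChartAt (𝓡 4) p).symm y) (X ((extChartAt (𝓡 4) p).symm y)) := by
  have h : (fromChart p y).inverse = toChart p ((extChartAt (𝓡 4) p).symm y) :=
    ContinuousLinearMap.inverse_eq (ContinuousLinearMap.ext (fromChart_toChart hy))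
      (ContinuousLinearMap.ext (toChart_fromChart hy))
  exact DFunLike.congr_fun h _

theorem fromChart_chartField (X : VField M) {p : M} {y : R4}
    (hy : y ∈ (extChartAt (𝓡 4) p).target) :
    fromChart p y (chartField p X y) = X ((extChartAt (𝓡 4) p).symm y) := by
  rw [chartField_eq X hy, fromChart_toChart hy]

theorem chartField_self (p : M) (X : VField M) :
    chartField p X (extChartAt (𝓡 4) p p) = X p := by
  rw [chartField_eq X (mem_extChartAt_target p), extChartAt_to_inv, toChart_self]

/-- The chart centred at `p` has identity derivative at `p`, so no transport of the bracket back to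
`Tan p` remains. -/
theorem mlieBracket_eq (X Y : VField M) (p : M) :
    mlieBracket (𝓡 4) X Y p =
      lieBracket ℝ (chartField p X) (chartField p Y) (extChartAt (𝓡 4) p p) := by
  have h : (toChart p p).inverse = ContinuousLinearMap.id ℝ (Tan p) :=
    ContinuousLinearMap.inverse_eq (ContinuousLinearMap.ext (toChart_self p))
      (ContinuousLinearMap.ext (toChart_self p))
  rw [mlieBracket, mlieBracketWithin_apply]
  refine (DFunLike.congr_fun h _).trans ?_
  simp only [ModelWithCorners.range_eq_univ, mpullbackWithin_univ, preimage_univ, inter_univ]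
  exact congrFun (lieBracketWithin_univ (𝕜 := ℝ) (E := R4)) _

theorem eventually_target (p : M) :
    ∀ᶠ y in 𝓝 (extChartAt (𝓡 4) p p), y ∈ (extChartAt (𝓡 4) p).target :=
  extChartAt_target_mem_nhds p

theorem tendsto_chart_symm (p : M) :
    Tendsto (extChartAt (𝓡 4) p).symm (𝓝 (extChartAt (𝓡 4) p p)) (𝓝 p) := by
  have := continuousAt_extChartAt_symm (I := 𝓡 4) p
  rwa [ContinuousAt, extChartAt_to_inv] at this

theorem contDiffAt_chartField {X : VField M} {p : M}
    (hX : ContMDiffAt (𝓡 4) (𝓡 4).tangent ∞ (fun p => (⟨p, X p⟩ : TangentBundle (𝓡 4) M)) p) :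
    ContDiffAt ℝ ∞ (chartField p X) (extChartAt (𝓡 4) p p) := by
  have := contMDiffWithinAt_mpullbackWithin_extChartAt_symm (n := ∞) (m := ∞) (s := univ)
    hX.contMDiffWithinAt uniqueMDiffOn_univ (mem_univ p) le_rfl
  refine contMDiffAt_vectorSpace_iff_contDiffAt.mp ?_
  simp only [ModelWithCorners.range_eq_univ, mpullbackWithin_univ, preimage_univ, inter_univ] at this
  exact this.contMDiffAt (extChartAt_target_mem_nhds p)

theorem contMDiffAt_real_iff {F : Type*} [NormedAddCommGroup F] [NormedSpace ℝ F]
    {u : M → F} {p : M} : ContMDiffAt (𝓡 4) 𝓘(ℝ, F) ∞ u p ↔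
      ContDiffAt ℝ ∞ (fun y => u ((extChartAt (𝓡 4) p).symm y)) (extChartAt (𝓡 4) p p) := by
  constructor
  · intro h
    rw [← contMDiffAt_iff_contDiffAt]
    have h1 : ContMDiffAt 𝓘(ℝ, R4) (𝓡 4) ∞ (extChartAt (𝓡 4) p).symm (extChartAt (𝓡 4) p p) :=
      (contMDiffOn_extChartAt_symm p).contMDiffAt (extChartAt_target_mem_nhds p)
    refine ContMDiffAt.comp _ ?_ h1
    rwa [extChartAt_to_inv]
  · intro h
    rw [← contMDiffAt_iff_contDiffAt] at h
    refine (h.comp p (contMDiffAt_extChartAt (x := p))).congr_of_eventuallyEq ?_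
    filter_upwards [extChartAt_source_mem_nhds (I := 𝓡 4) p] with q hq
    rw [Function.comp_apply, (extChartAt (𝓡 4) p).left_inv hq]

/-- A field of bilinear forms read in the chart centred at `p`. -/
noncomputable def chartBilin (p : M) (b : (p : M) → Tan p →L[ℝ] Tan p →L[ℝ] ℝ) (y : R4) :
    R4 →L[ℝ] R4 →L[ℝ] ℝ :=
  ContinuousLinearMap.bilinearComp (E := R4) (F := R4)
    (b ((extChartAt (𝓡 4) p).symm y)) (fromChart p y) (fromChart p y)

/-- Near `p` the trivialisation of the tangent bundle is the derivative of the chart, so the bundle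
coordinates of `b` are `chartBilin`. -/
theorem contMDiffAt_bilin_iff {b : (p : M) → Tan p →L[ℝ] Tan p →L[ℝ] ℝ} {p : M} :
    ContMDiffAt (𝓡 4) ((𝓡 4).prod 𝓘(ℝ, R4 →L[ℝ] R4 →L[ℝ] ℝ)) ∞
    (fun p => TotalSpace.mk' (R4 →L[ℝ] R4 →L[ℝ] ℝ)
      (E := fun p : M => Tan p →L[ℝ] Tan p →L[ℝ] ℝ) p (b p)) p ↔
    ContDiffAt ℝ ∞ (chartBilin p b) (extChartAt (𝓡 4) p p) := by
  rw [contMDiffAt_hom_bundle]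
  refine (and_iff_right contMDiffAt_id).trans (contMDiffAt_real_iff.trans ?_)
  refine (contDiffAt_congr ?_)
  filter_upwards [eventually_target p] with y hy
  ext u v
  have hq : (extChartAt (𝓡 4) p).symm y ∈ (chartAt R4 p).source := by
    simpa using (extChartAt (𝓡 4) p).map_target hy
  have hs : ∀ w : R4, (trivializationAt R4 Tan p).symm ((extChartAt (𝓡 4) p).symm y) w =
      fromChart p y w := fun w => by
    have := TangentBundle.symmL_trivializationAt (I := 𝓡 4) hq
    rw [(extChartAt (𝓡 4) p).right_inv hy, ← fromChart_eq] at this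
    exact (Trivialization.symmL_apply (R := ℝ) _ hq w).symm.trans (DFunLike.congr_fun this w)
  have := inCoordinates_apply_eq₂ (F₁ := R4) (F₂ := R4) (F₃ := ℝ)
    (E₁ := Tan (M := M)) (E₂ := Tan (M := M)) (E₃ := Bundle.Trivial M ℝ) (x₀ := p)
    (ϕ := b ((extChartAt (𝓡 4) p).symm y)) (v := u) (w := v) hq hq (mem_univ _)
  rw [hs, hs, Trivialization.linearMapAt_apply] at this
  exact this.trans (if_pos (mem_univ _))

/-- A field of endomorphisms read in the chart centred at `p`. -/
noncomputable def chartEndo (p : M) (J : (p : M) → Tan p →L[ℝ] Tan p) (y : R4) : R4 →L[ℝ] R4 :=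
  toChart p ((extChartAt (𝓡 4) p).symm y) ∘L J ((extChartAt (𝓡 4) p).symm y) ∘L fromChart p y

theorem contMDiffAt_endo_iff {J : (p : M) → Tan p →L[ℝ] Tan p} {p : M} :
    ContMDiffAt (𝓡 4) ((𝓡 4).prod 𝓘(ℝ, R4 →L[ℝ] R4)) ∞
    (fun p => TotalSpace.mk' (R4 →L[ℝ] R4) (E := fun p : M => Tan p →L[ℝ] Tan p) p (J p)) p ↔
    ContDiffAt ℝ ∞ (chartEndo p J) (extChartAt (𝓡 4) p p) := by
  rw [contMDiffAt_hom_bundle]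
  refine (and_iff_right contMDiffAt_id).trans (contMDiffAt_real_iff.trans ?_)
  refine (contDiffAt_congr ?_)
  filter_upwards [eventually_target p] with y hy
  have hq : (extChartAt (𝓡 4) p).symm y ∈ (chartAt R4 p).source := by
    simpa using (extChartAt (𝓡 4) p).map_target hy
  dsimp only [ContinuousLinearMap.inCoordinates]
  rw [TangentBundle.continuousLinearMapAt_trivializationAt hq,
    TangentBundle.symmL_trivializationAt hq, (extChartAt (𝓡 4) p).right_inv hy, ← fromChart_eq]
  rfl

end Charts

/-! ### Local calculus on a vector space: Nijenhuis tensor, Levi-Civita connection, one-forms. -/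

section Flat

variable {E : Type*} [NormedAddCommGroup E] [NormedSpace ℝ E]

/-- The Nijenhuis tensor of a field of endomorphisms of a vector space. -/
noncomputable def flatNijenhuis (J : E → E →L[ℝ] E) (z u v : E) : E :=
  fderiv ℝ J z (J z u) v - fderiv ℝ J z (J z v) u + J z (fderiv ℝ J z v u)
    - J z (fderiv ℝ J z u v)

/-- Tensoriality: by `J² = -1` all derivatives of `X` and `Y` cancel, and only the derivative of `J`
survives. -/
theorem lieBracket_eq_flatNijenhuis {J : E → E →L[ℝ] E} {X Y : E → E} {z : E}
    (hJ : DifferentiableAt ℝ J z) (hX : DifferentiableAt ℝ X z) (hY : DifferentiableAt ℝ Y z)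
    (hsq : ∀ u, J z (J z u) = -u) :
    lieBracket ℝ (fun y => J y (X y)) (fun y => J y (Y y)) z
      - J z (lieBracket ℝ (fun y => J y (X y)) Y z) - J z (lieBracket ℝ X (fun y => J y (Y y)) z)
      - lieBracket ℝ X Y z = flatNijenhuis J z (X z) (Y z) := by
  have e1 : fderiv ℝ (fun y => J y (X y)) z = _ := fderiv_clm_apply hJ hX
  have e2 : fderiv ℝ (fun y => J y (Y y)) z = _ := fderiv_clm_apply hJ hY
  simp only [lieBracket_eq, e1, e2, flatNijenhuis, add_apply, map_sub, map_add, hsq,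
    ContinuousLinearMap.comp_apply, ContinuousLinearMap.flip_apply]
  abel

/-- Differentiating `J² = -1` shows that the derivative of `J` anticommutes with `J`; this is the
source of the antilinearity of the Nijenhuis tensor. -/
theorem fderiv_comp_of_sq {J : E → E →L[ℝ] E} {z : E} (hJ : DifferentiableAt ℝ J z)
    (hsq : ∀ᶠ y in 𝓝 z, ∀ u, J y (J y u) = -u) (w u : E) :
    fderiv ℝ J z w (J z u) = -J z (fderiv ℝ J z w u) := by
  have hu : DifferentiableAt ℝ (fun y => J y u) z := hJ.clm_apply (differentiableAt_const u)
  have e1 : fderiv ℝ (fun y => J y u) z w = fderiv ℝ J z w u := by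
    rw [fderiv_clm_apply hJ (differentiableAt_const u)]; simp
  have e2 : fderiv ℝ (fun y => J y (J y u)) z w = 0 := by
    have : (fun y => J y (J y u)) =ᶠ[𝓝 z] fun _ => -u := hsq.mono fun y h => h u
    rw [this.fderiv_eq]; simp
  rw [fderiv_clm_apply hJ hu] at e2
  simp only [add_apply, ContinuousLinearMap.comp_apply, ContinuousLinearMap.flip_apply, e1] at e2
  exact eq_neg_of_add_eq_zero_right e2

theorem flatNijenhuis_swap (J : E → E →L[ℝ] E) (z u v : E) :
    flatNijenhuis J z v u = -flatNijenhuis J z u v := by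
  simp only [flatNijenhuis]; abel

theorem flatNijenhuis_map_right {J : E → E →L[ℝ] E} {z : E} (hJ : DifferentiableAt ℝ J z)
    (hsq : ∀ᶠ y in 𝓝 z, ∀ u, J y (J y u) = -u) (u v : E) :
    flatNijenhuis J z u (J z v) = -J z (flatNijenhuis J z u v) := by
  have h := hsq.self_of_nhds
  simp only [flatNijenhuis, h, fderiv_comp_of_sq hJ hsq, map_neg, map_add, map_sub, neg_apply]
  abel

theorem flatNijenhuis_map_left {J : E → E →L[ℝ] E} {z : E} (hJ : DifferentiableAt ℝ J z)
    (hsq : ∀ᶠ y in 𝓝 z, ∀ u, J y (J y u) = -u) (u v : E) :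
    flatNijenhuis J z (J z u) v = -J z (flatNijenhuis J z u v) := by
  rw [flatNijenhuis_swap, flatNijenhuis_map_right hJ hsq, flatNijenhuis_swap J z u v, map_neg, neg_neg]

theorem flatNijenhuis_add_right (J : E → E →L[ℝ] E) (z u v w : E) :
    flatNijenhuis J z u (v + w) = flatNijenhuis J z u v + flatNijenhuis J z u w := by
  simp only [flatNijenhuis, map_add, add_apply]; abel

theorem flatNijenhuis_smul_right (J : E → E →L[ℝ] E) (z u v : E) (c : ℝ) :
    flatNijenhuis J z u (c • v) = c • flatNijenhuis J z u v := by
  simp only [flatNijenhuis, map_smul, smul_apply, smul_add, smul_sub]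

theorem flatNijenhuis_add_left (J : E → E →L[ℝ] E) (z u v w : E) :
    flatNijenhuis J z (v + w) u = flatNijenhuis J z v u + flatNijenhuis J z w u := by
  simp only [flatNijenhuis, map_add, add_apply]; abel

theorem flatNijenhuis_smul_left (J : E → E →L[ℝ] E) (z u v : E) (c : ℝ) :
    flatNijenhuis J z (c • v) u = c • flatNijenhuis J z v u := by
  simp only [flatNijenhuis, map_smul, smul_apply, smul_add, smul_sub]

theorem flatNijenhuis_self (J : E → E →L[ℝ] E) (z u : E) : flatNijenhuis J z u u = 0 := by
  simp [flatNijenhuis]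

/-- In dimension four the Nijenhuis tensor vanishes as soon as it does on one pair of vectors
spanning over the complex numbers. -/
theorem flatNijenhuis_eq_zero {J : E → E →L[ℝ] E} {z : E} (hJ : DifferentiableAt ℝ J z)
    (hsq : ∀ᶠ y in 𝓝 z, ∀ u, J y (J y u) = -u) {k x : E}
    (hspan : ∀ u : E, ∃ a b c d : ℝ, u = a • k + b • J z k + c • x + d • J z x)
    (h0 : flatNijenhuis J z k x = 0) (u v : E) : flatNijenhuis J z u v = 0 := by
  have h1 : flatNijenhuis J z x k = 0 := by rw [flatNijenhuis_swap, h0, neg_zero]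
  obtain ⟨a, b, c, d, rfl⟩ := hspan u
  obtain ⟨a', b', c', d', rfl⟩ := hspan v
  -- The pairs `(k, J k)` and `(x, J x)` contribute nothing, by antilinearity and `N(u, u) = 0`;
  -- every other pair reduces to `N(k, x)` or `N(x, k)`.
  simp only [flatNijenhuis_add_right, flatNijenhuis_add_left, flatNijenhuis_smul_right,
    flatNijenhuis_smul_left, flatNijenhuis_map_right hJ hsq, flatNijenhuis_map_left hJ hsq,
    flatNijenhuis_self, h0, h1, map_zero, neg_zero, smul_zero, add_zero]

/-- The Koszul form of the connection: lowering the index removes the inverse metric, which is a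
genuine inverse only under `hg`. -/
theorem flatNabla_apply (g : E → E →L[ℝ] E →L[ℝ] ℝ) (X : E → E) {z : E}
    (hg : (g z).IsInvertible) (v w : E) :
    g z (flatNabla g X z v) w = g z (fderiv ℝ X z v) w
      + (1 / 2) * (fderiv ℝ g z v (X z) w + fderiv ℝ g z (X z) v w - fderiv ℝ g z w (X z) v) := by
  have h : ∀ T, g z ((g z).inverse T) = T := fun T => by
    obtain ⟨e, he⟩ := hg
    rw [← he, ContinuousLinearMap.inverse_equiv]
    exact e.apply_symm_apply T
  simp only [flatNabla, add_apply, smul_apply, map_add, map_smul, ContinuousLinearMap.comp_apply, h,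
    sub_apply, ContinuousLinearMap.flip_apply, smul_eq_mul]

theorem fderiv_symm {g : E → E →L[ℝ] E →L[ℝ] ℝ} {z : E} (hg : DifferentiableAt ℝ g z)
    (hs : ∀ᶠ y in 𝓝 z, ∀ u v, g y u v = g y v u) (w u v : E) :
    fderiv ℝ g z w u v = fderiv ℝ g z w v u := by
  have e : ∀ u v, fderiv ℝ (fun y => g y u v) z w = fderiv ℝ g z w u v := fun u v => by
    rw [fderiv_clm_apply (hg.clm_apply (differentiableAt_const u)) (differentiableAt_const v),
      fderiv_clm_apply hg (differentiableAt_const u)]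
    simp
  rw [← e, ← e]
  have : (fun y => g y u v) =ᶠ[𝓝 z] fun y => g y v u := hs.mono fun y h => h u v
  rw [this.fderiv_eq]

/-- The Christoffel terms skew in `u, v` cancel; what remains is the Lie derivative of `g` along
`X`, written in coordinates. -/
theorem flatNabla_add_swap {g : E → E →L[ℝ] E →L[ℝ] ℝ} {z : E} (hg : DifferentiableAt ℝ g z)
    (hs : ∀ᶠ y in 𝓝 z, ∀ u v, g y u v = g y v u) (hi : (g z).IsInvertible) (X : E → E) (u v : E) :
    g z (flatNabla g X z u) v + g z (flatNabla g X z v) u =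
      g z (fderiv ℝ X z u) v + g z (fderiv ℝ X z v) u + fderiv ℝ g z (X z) u v := by
  rw [flatNabla_apply g X hi, flatNabla_apply g X hi, fderiv_symm hg hs (X z) v u]
  ring

/-- The left side is `dX^♭(u, v)`; antisymmetrising the connection leaves precisely the skew
Christoffel terms. -/
theorem flatNabla_sub_swap {g : E → E →L[ℝ] E →L[ℝ] ℝ} {z : E} (hg : DifferentiableAt ℝ g z)
    (hs : ∀ᶠ y in 𝓝 z, ∀ u v, g y u v = g y v u) (hi : (g z).IsInvertible) {X : E → E}
    (hX : DifferentiableAt ℝ X z) (u v : E) :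
    fderiv ℝ (fun y => g y (X y)) z u v - fderiv ℝ (fun y => g y (X y)) z v u =
      g z (flatNabla g X z u) v - g z (flatNabla g X z v) u := by
  rw [flatNabla_apply g X hi, flatNabla_apply g X hi, fderiv_symm hg hs (X z) v u,
    fderiv_clm_apply hg hX]
  simp only [add_apply, ContinuousLinearMap.comp_apply, ContinuousLinearMap.flip_apply]
  ring

/-- The Lie derivative of the metric is the symmetrised covariant derivative. -/
theorem lieBracket_metric {g : E → E →L[ℝ] E →L[ℝ] ℝ} {z : E} (hg : DifferentiableAt ℝ g z)
    (hs : ∀ᶠ y in 𝓝 z, ∀ u v, g y u v = g y v u) (hi : (g z).IsInvertible) {K X Y : E → E}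
    (hX : DifferentiableAt ℝ X z) (hY : DifferentiableAt ℝ Y z) {c : ℝ}
    (h : ∀ᶠ y in 𝓝 z, g y (X y) (Y y) = c) :
    g z (lieBracket ℝ K X z) (Y z) + g z (lieBracket ℝ K Y z) (X z) =
      -(g z (flatNabla g K z (X z)) (Y z) + g z (flatNabla g K z (Y z)) (X z)) := by
  have hs' := hs.self_of_nhds
  -- As `g(X, Y)` is constant, `(L_K g)(X, Y) = -g([K, X], Y) - g(X, [K, Y])`; expanding `K(g(X, Y))
  -- = 0` expresses this in coordinates.
  have e2 : fderiv ℝ (fun y => g y (X y) (Y y)) z (K z) = 0 := by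
    have : (fun y => g y (X y) (Y y)) =ᶠ[𝓝 z] fun _ => c := h
    rw [this.fderiv_eq]; simp
  rw [fderiv_clm_apply (hg.clm_apply hX) hY, fderiv_clm_apply hg hX] at e2
  simp only [add_apply, ContinuousLinearMap.comp_apply, ContinuousLinearMap.flip_apply] at e2
  rw [flatNabla_add_swap hg hs hi]
  simp only [lieBracket_eq, map_sub, sub_apply]
  linear_combination e2 + hs' (fderiv ℝ Y z (K z)) (X z)

/-- `dθ(K, X) = -X(θ(K)) - θ([K, X])` if `θ(X) = 0`. -/
theorem fderiv_sub_swap_of_apply_eq_zero {θ : E → E →L[ℝ] ℝ} {z : E} (hθ : DifferentiableAt ℝ θ z)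
    {K X : E → E} (hK : DifferentiableAt ℝ K z) (hX : DifferentiableAt ℝ X z)
    (h : ∀ᶠ y in 𝓝 z, θ y (X y) = 0) :
    fderiv ℝ θ z (K z) (X z) - fderiv ℝ θ z (X z) (K z) =
      -fderiv ℝ (fun y => θ y (K y)) z (X z) - θ z (lieBracket ℝ K X z) := by
  have e2 : fderiv ℝ (fun y => θ y (X y)) z (K z) = 0 := by
    have : (fun y => θ y (X y)) =ᶠ[𝓝 z] fun _ => 0 := h
    rw [this.fderiv_eq]; simp
  rw [fderiv_clm_apply hθ hX] at e2
  rw [fderiv_clm_apply hθ hK]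
  simp only [lieBracket_eq, map_sub, add_apply, ContinuousLinearMap.comp_apply,
    ContinuousLinearMap.flip_apply] at e2 ⊢
  linear_combination e2

/-- A one-form on a vector space, as an alternating map. -/
noncomputable def flatOneForm (θ : E →L[ℝ] ℝ) : E [⋀^Fin 1]→L[ℝ] ℝ :=
  ContinuousAlternatingMap.ofSubsingletonLIE (𝕜 := ℝ) (E := E) (F := ℝ) (0 : Fin 1) θ

theorem differentiableAt_flatOneForm {θ : E → E →L[ℝ] ℝ} {z : E} (hθ : DifferentiableAt ℝ θ z) :
    DifferentiableAt ℝ (fun y => flatOneForm (θ y)) z :=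
  (ContinuousAlternatingMap.ofSubsingletonLIE (𝕜 := ℝ) (E := E) (F := ℝ)
    (0 : Fin 1)).toContinuousLinearEquiv.differentiableAt.comp z hθ

theorem contDiffAt_flatOneForm {θ : E → E →L[ℝ] ℝ} {z : E} (hθ : ContDiffAt ℝ ∞ θ z) :
    ContDiffAt ℝ ∞ (fun y => flatOneForm (θ y)) z :=
  (ContinuousAlternatingMap.ofSubsingletonLIE (𝕜 := ℝ) (E := E) (F := ℝ)
    (0 : Fin 1)).toContinuousLinearEquiv.contDiff.contDiffAt.comp z hθ

theorem extDeriv_flatOneForm {θ : E → E →L[ℝ] ℝ} {z : E} (hθ : DifferentiableAt ℝ θ z) (u v : E) :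
    extDeriv (fun y => flatOneForm (θ y)) z ![u, v] = fderiv ℝ θ z u v - fderiv ℝ θ z v u := by
  have e : ∀ (w : Fin 1 → E), (fun y => flatOneForm (θ y) w) = fun y => θ y (w 0) := fun w => rfl
  rw [extDeriv_apply (differentiableAt_flatOneForm hθ), Fin.sum_univ_two]
  simp only [e, fderiv_clm_apply hθ (differentiableAt_const _)]
  simp [Fin.removeNth, sub_eq_add_neg]

/-- The algebraic heart of integrability: for a local orthonormal frame `x, y = J x` of the
orthogonal complement of `k, t = J k`, preserved by brackets with `k` and `t`, the component
`N(k, x)` of the Nijenhuis tensor vanishes if the shears of `k` and `t` are related by `J`. -/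
theorem flatNijenhuis_frame {g : E → E →L[ℝ] E →L[ℝ] ℝ} {J : E → E →L[ℝ] E} {k t x y : E → E}
    {z : E} (hg : DifferentiableAt ℝ g z)
    (hs : ∀ᶠ q in 𝓝 z, ∀ u v, g q u v = g q v u) (hi : (g z).IsInvertible)
    (hJ : DifferentiableAt ℝ J z) (hk : DifferentiableAt ℝ k z)
    (hx : DifferentiableAt ℝ x z) (hy : DifferentiableAt ℝ y z)
    (hsq : ∀ u, J z (J z u) = -u)
    (hJk : ∀ᶠ q in 𝓝 z, J q (k q) = t q) (hJx : ∀ᶠ q in 𝓝 z, J q (x q) = y q)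
    (hxx : ∀ᶠ q in 𝓝 z, g q (x q) (x q) = 1) (hyy : ∀ᶠ q in 𝓝 z, g q (y q) (y q) = 1)
    (hxy : ∀ᶠ q in 𝓝 z, g q (x q) (y q) = 0)
    (hkx : ∃ a b : ℝ, lieBracket ℝ k x z = a • x z + b • y z)
    (hky : ∃ a b : ℝ, lieBracket ℝ k y z = a • x z + b • y z)
    (htx : ∃ a b : ℝ, lieBracket ℝ t x z = a • x z + b • y z)
    (hty : ∃ a b : ℝ, lieBracket ℝ t y z = a • x z + b • y z)
    (h1 : g z (flatNabla g k z (x z)) (x z) - g z (flatNabla g k z (y z)) (y z) =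
      g z (flatNabla g t z (x z)) (y z) + g z (flatNabla g t z (y z)) (x z))
    (h2 : g z (flatNabla g t z (x z)) (x z) - g z (flatNabla g t z (y z)) (y z) =
      -(g z (flatNabla g k z (x z)) (y z) + g z (flatNabla g k z (y z)) (x z))) :
    flatNijenhuis J z (k z) (x z) = 0 := by
  -- Back to brackets, so that `J k = t` and `J x = y` near `z` can be substituted: `N(k, x) = [t,
  -- y] - J[t, x] - J[k, y] - [k, x]`.
  rw [← lieBracket_eq_flatNijenhuis hJ hk hx hsq]
  have eJk : (fun q => J q (k q)) =ᶠ[𝓝 z] t := hJk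
  have eJx : (fun q => J q (x q)) =ᶠ[𝓝 z] y := hJx
  rw [eJk.lieBracket_vectorField_eq eJx, eJk.lieBracket_vectorField_eq EventuallyEq.rfl,
    EventuallyEq.rfl.lieBracket_vectorField_eq eJx]
  have ex : J z (x z) = y z := hJx.self_of_nhds
  have ey : J z (y z) = -x z := by rw [← ex, hsq]
  have sxx := hxx.self_of_nhds
  have syy := hyy.self_of_nhds
  have sxy := hxy.self_of_nhds
  have syx : g z (y z) (x z) = 0 := by rw [hs.self_of_nhds, sxy]
  obtain ⟨a, b, e1⟩ := hkx
  obtain ⟨c, d, e2⟩ := hky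
  obtain ⟨a', b', e3⟩ := htx
  obtain ⟨c', d', e4⟩ := hty
  have f1 := lieBracket_metric hg hs hi (K := k) hx hx hxx
  have f2 := lieBracket_metric hg hs hi (K := k) hy hy hyy
  have f3 := lieBracket_metric hg hs hi (K := k) hx hy hxy
  have f4 := lieBracket_metric hg hs hi (K := t) hx hx hxx
  have f5 := lieBracket_metric hg hs hi (K := t) hy hy hyy
  have f6 := lieBracket_metric hg hs hi (K := t) hx hy hxy
  simp only [e1, e2, e3, e4, map_add, map_smul, add_apply, smul_apply, sxx, syy, sxy, syx,
    smul_eq_mul, mul_one, mul_zero, add_zero, zero_add] at f1 f2 f3 f4 f5 f6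
  simp only [e1, e2, e3, e4, map_add, map_smul, ex, ey]
  -- These are the `x`- and `y`-components of `N(k, x)`. Only off-diagonal sums and diagonal
  -- differences of the bracket matrices enter, so `f1`–`f6` turn them into the shear identities
  -- `h1` and `h2`.
  have g1 : c' + b' + d - a = 0 := by linarith
  have g2 : d' - a' - c - b = 0 := by linarith
  calc _ = (c' + b' + d - a) • x z + (d' - a' - c - b) • y z := by module
    _ = 0 := by rw [g1, g2]; simp

end Flat

/-! ### Smooth orthonormal frames of `ℋ`. -/

section Frames

variable {M : Type*} [TopologicalSpace M] [ChartedSpace R4 M] [IsManifold (𝓡 4) ∞ M]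

/-- Smoothness of a vector field at a point. -/
def SmoothFieldAt (X : VField M) (p : M) : Prop :=
  ContMDiffAt (𝓡 4) (𝓡 4).tangent ∞ (fun p => (⟨p, X p⟩ : TangentBundle (𝓡 4) M)) p

theorem SmoothFieldOn.smoothFieldAt {X : VField M} {U : Set M} (h : SmoothFieldOn X U)
    {p : M} (hU : U ∈ 𝓝 p) : SmoothFieldAt X p :=
  ContMDiffOn.contMDiffAt h hU

theorem SmoothFieldAt.smul {u : M → ℝ} {X : VField M} {p : M}
    (hu : ContMDiffAt (𝓡 4) 𝓘(ℝ, ℝ) ∞ u p) (hX : SmoothFieldAt X p) :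
    SmoothFieldAt (fun q => u q • X q) p :=
  ContMDiffAt.smul_section hu hX

theorem SmoothFieldAt.sub {X Y : VField M} {p : M}
    (hX : SmoothFieldAt X p) (hY : SmoothFieldAt Y p) : SmoothFieldAt (fun q => X q - Y q) p :=
  ContMDiffAt.sub_section hX hY

/-- Any vector field that is smooth near `p` agrees near `p` with a smooth multiple of it. -/
theorem exists_bump_smul [T2Space M] {X : VField M} {p : M}
    (hX : ∀ᶠ q in 𝓝 p, SmoothFieldAt X q) :
    ∃ χ : M → ℝ, SmoothFieldOn (fun q => χ q • X q) univ ∧ ∀ᶠ q in 𝓝 p, χ q = 1 := by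
  obtain ⟨V, hV, hVo, hpV⟩ := eventually_nhds_iff.mp hX
  obtain ⟨χ, -, hχ⟩ := (SmoothBumpFunction.nhds_basis_tsupport (I := 𝓡 4) p).mem_iff.mp
    (hVo.mem_nhds hpV)
  refine ⟨χ, ?_, χ.eventuallyEq_one⟩
  exact (ContMDiffOn.smul_section_of_tsupport χ.contMDiff.contMDiffOn hVo hχ
    fun q hq => (hV q hq).contMDiffWithinAt).contMDiffOn

theorem exists_smoothFieldAt_extend {p : M} (v : Tan p) :
    ∃ X : VField M, X p = v ∧ ∀ᶠ q in 𝓝 p, SmoothFieldAt X q := by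
  obtain ⟨s, hs, h⟩ := FiberBundle.exists_contMDiffOn_extend (k := ∞) (𝓡 4) R4
    (V := Tan (M := M)) v
  refine ⟨FiberBundle.extend R4 v, by simp, ?_⟩
  filter_upwards [eventually_mem_nhds_iff.mpr hs] with q hq
  exact h.contMDiffAt hq

namespace SemiRiemannianMetric

theorem contMDiffAt_val (g : SemiRiemannianMetric M) {X Y : VField M} {p : M}
    (hX : SmoothFieldAt X p) (hY : SmoothFieldAt Y p) :
    ContMDiffAt (𝓡 4) 𝓘(ℝ, ℝ) ∞ (fun q => g.val q (X q) (Y q)) p := by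
  have hg := contMDiffAt_bilin_iff.mp (ContMDiffOn.contMDiffAt g.smooth (x := p) univ_mem)
  rw [contMDiffAt_real_iff]
  refine (contDiffAt_congr ?_).mp ((hg.clm_apply (contDiffAt_chartField hX)).clm_apply
    (contDiffAt_chartField hY))
  filter_upwards [eventually_target p] with y hy
  have := congrArg₂ (fun u v => g.val ((extChartAt (𝓡 4) p).symm y) u v)
    (fromChart_chartField X hy) (fromChart_chartField Y hy)
  exact this

theorem gramDet_eq (g : SemiRiemannianMetric M) (k t : VField M) (p : M) :
    g.gramDet k t p = g.val p (k p) (k p) * g.val p (t p) (t p) - g.val p (k p) (t p) ^ 2 := by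
  rw [gramDet, Matrix.det_fin_two_of, g.symm p (t p) (k p), sq]

/-- A kernel vector of the Gram matrix would give a nonzero vector in `𝒱 ∩ ℋ`; it is orthogonal to
itself, against positivity on `ℋ`. So `𝒱` and `ℋ` are complementary. -/
theorem gramDet_ne_zero (g : SemiRiemannianMetric M) {k t : VField M} {p : M}
    (hli : LinearIndependent ℝ ![k p, t p])
    (hpos : ∀ x ∈ g.horiz k t p, x ≠ 0 → 0 < g.val p x x) : g.gramDet k t p ≠ 0 := by
  intro h0
  obtain ⟨c, hc, hv⟩ := Matrix.exists_mulVec_eq_zero_iff.mpr h0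
  have e1 := congrFun hv 0
  have e2 := congrFun hv 1
  simp only [Matrix.mulVec, dotProduct, Fin.sum_univ_two, Matrix.of_apply, Matrix.cons_val',
    Matrix.cons_val_zero, Matrix.cons_val_one, Matrix.cons_val_fin_one, Pi.zero_apply] at e1 e2
  have h1 : g.val p (k p) (c 0 • k p + c 1 • t p) = 0 := by
    rw [map_add, map_smul, map_smul, smul_eq_mul, smul_eq_mul]; linarith
  have h2 : g.val p (t p) (c 0 • k p + c 1 • t p) = 0 := by
    rw [map_add, map_smul, map_smul, smul_eq_mul, smul_eq_mul]; linarith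
  have hne : c 0 • k p + c 1 • t p ≠ 0 := fun h => by
    have := LinearIndependent.pair_iff.mp hli _ _ h
    exact hc (funext fun i => by fin_cases i <;> simp [this.1, this.2])
  have := hpos _ ⟨h1, h2⟩ hne
  rw [g.symm, map_add, map_smul, map_smul, g.symm, h1, g.symm, h2] at this
  simp at this

theorem proj_apply (g : SemiRiemannianMetric M) (k t : VField M) (p : M) (v : Tan p) :
    g.proj k t p v = v
      - (g.val p (t p) (t p) / g.gramDet k t p * g.val p (k p) v
        - g.val p (k p) (t p) / g.gramDet k t p * g.val p (t p) v) • k p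
      - (g.val p (k p) (k p) / g.gramDet k t p * g.val p (t p) v
        - g.val p (k p) (t p) / g.gramDet k t p * g.val p (k p) v) • t p := rfl

theorem proj_mem_horiz (g : SemiRiemannianMetric M) {k t : VField M} {p : M}
    (hG : g.gramDet k t p ≠ 0) (v : Tan p) : g.proj k t p v ∈ g.horiz k t p := by
  have e := g.gramDet_eq k t p
  have hs := g.symm p (t p) (k p)
  constructor
  · rw [proj_apply]
    simp only [map_sub, map_smul, smul_eq_mul]
    field_simp
    rw [e]; ring
  · rw [proj_apply]
    simp only [map_sub, map_smul, smul_eq_mul, hs]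
    field_simp
    rw [e]; ring

theorem proj_of_mem_horiz (g : SemiRiemannianMetric M) {k t : VField M} {p : M} {v : Tan p}
    (hv : v ∈ g.horiz k t p) : g.proj k t p v = v := by
  rw [proj_apply, hv.1, hv.2]; simp

theorem smoothFieldAt_proj (g : SemiRiemannianMetric M) {k t X : VField M} {p : M}
    (hk : SmoothFieldAt k p) (ht : SmoothFieldAt t p) (hX : SmoothFieldAt X p)
    (hG : g.gramDet k t p ≠ 0) : SmoothFieldAt (fun q => g.proj k t q (X q)) p := by
  have hkk := g.contMDiffAt_val hk hk
  have hkt := g.contMDiffAt_val hk ht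
  have htt := g.contMDiffAt_val ht ht
  have hkX := g.contMDiffAt_val hk hX
  have htX := g.contMDiffAt_val ht hX
  have hGs : ContMDiffAt (𝓡 4) 𝓘(ℝ, ℝ) ∞ (fun q => g.gramDet k t q) p := by
    simp only [gramDet_eq]
    rw [contMDiffAt_real_iff] at *
    exact (hkk.mul htt).sub (hkt.pow 2)
  simp only [proj_apply]
  refine (hX.sub (.smul ?_ hk)).sub (.smul ?_ ht)
  · rw [contMDiffAt_real_iff] at *
    have hG' : g.gramDet k t ((extChartAt (𝓡 4) p).symm (extChartAt (𝓡 4) p p)) ≠ 0 := by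
      rwa [extChartAt_to_inv]
    exact ((htt.div hGs hG').mul hkX).sub ((hkt.div hGs hG').mul htX)
  · rw [contMDiffAt_real_iff] at *
    have hG' : g.gramDet k t ((extChartAt (𝓡 4) p).symm (extChartAt (𝓡 4) p p)) ≠ 0 := by
      rwa [extChartAt_to_inv]
    exact ((hkk.div hGs hG').mul htX).sub ((hkt.div hGs hG').mul hkX)

/-- Normalisation of a vector field of positive length. -/
theorem smoothFieldAt_normalize (g : SemiRiemannianMetric M) {X : VField M} {p : M}
    (hX : SmoothFieldAt X p) (hp : 0 < g.val p (X p) (X p)) :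
    SmoothFieldAt (fun q => (Real.sqrt (g.val q (X q) (X q)))⁻¹ • X q) p := by
  refine .smul ?_ hX
  have h := g.contMDiffAt_val hX hX
  rw [contMDiffAt_real_iff] at *
  have h1 : g.val ((extChartAt (𝓡 4) p).symm (extChartAt (𝓡 4) p p))
      (X ((extChartAt (𝓡 4) p).symm (extChartAt (𝓡 4) p p)))
      (X ((extChartAt (𝓡 4) p).symm (extChartAt (𝓡 4) p p))) = g.val p (X p) (X p) := by
    rw [extChartAt_to_inv]
  refine (h.sqrt ?_).inv ?_
  · rw [h1]; exact hp.ne'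
  · rw [h1]; exact (Real.sqrt_pos.mpr hp).ne'

theorem val_normalize (g : SemiRiemannianMetric M) {p : M} {v : Tan p} (hp : 0 < g.val p v v) :
    g.val p ((Real.sqrt (g.val p v v))⁻¹ • v) ((Real.sqrt (g.val p v v))⁻¹ • v) = 1 := by
  have h4 := Real.mul_self_sqrt hp.le
  have h5 := (Real.sqrt_pos.mpr hp).ne'
  simp only [map_smul, smul_apply, smul_eq_mul]
  field_simp
  rw [sq, h4]

/-- Near every point `ℋ` has a smooth orthonormal frame with prescribed initial values. -/
theorem exists_smooth_orthonormal [T2Space M] (g : SemiRiemannianMetric M) {k t : VField M}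
    (hk : SmoothFieldOn k univ) (ht : SmoothFieldOn t univ)
    (hG : ∀ p, g.gramDet k t p ≠ 0) {p : M} {x y : Tan p}
    (hx : x ∈ g.horiz k t p) (hy : y ∈ g.horiz k t p) (hxx : g.val p x x = 1)
    (hyy : g.val p y y = 1) (hxy : g.val p x y = 0) :
    ∃ X Y : VField M, X p = x ∧ Y p = y ∧ SmoothFieldOn X univ ∧ SmoothFieldOn Y univ ∧
      (∀ q, X q ∈ g.horiz k t q) ∧ (∀ q, Y q ∈ g.horiz k t q) ∧
      ∀ᶠ q in 𝓝 p, g.val q (X q) (X q) = 1 ∧ g.val q (Y q) (Y q) = 1 ∧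
        g.val q (X q) (Y q) = 0 := by
  have hk' : ∀ q, SmoothFieldAt k q := fun q => hk.smoothFieldAt univ_mem
  have ht' : ∀ q, SmoothFieldAt t q := fun q => ht.smoothFieldAt univ_mem
  obtain ⟨A, hA, hAs⟩ := exists_smoothFieldAt_extend x
  obtain ⟨B, hB, hBs⟩ := exists_smoothFieldAt_extend y
  -- Gram–Schmidt applied to the projections onto `ℋ`. The initial vectors are already horizontal
  -- and orthonormal, so the values at `p` do not change.
  let A1 : VField M := fun q => g.proj k t q (A q)
  let B1 : VField M := fun q => g.proj k t q (B q)
  have hA1 : ∀ᶠ q in 𝓝 p, SmoothFieldAt A1 q :=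
    hAs.mono fun q h => g.smoothFieldAt_proj (hk' q) (ht' q) h (hG q)
  have hB1 : ∀ᶠ q in 𝓝 p, SmoothFieldAt B1 q :=
    hBs.mono fun q h => g.smoothFieldAt_proj (hk' q) (ht' q) h (hG q)
  have hA1p : A1 p = x := by simp only [A1, hA, g.proj_of_mem_horiz hx]
  have hB1p : B1 p = y := by simp only [B1, hB, g.proj_of_mem_horiz hy]
  have hpA : ∀ᶠ q in 𝓝 p, 0 < g.val q (A1 q) (A1 q) :=
    (g.contMDiffAt_val hA1.self_of_nhds hA1.self_of_nhds).continuousAt.eventually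
      (lt_mem_nhds (by beta_reduce; rw [hA1p, hxx]; exact one_pos))
  let X : VField M := fun q => (Real.sqrt (g.val q (A1 q) (A1 q)))⁻¹ • A1 q
  have hX : ∀ᶠ q in 𝓝 p, SmoothFieldAt X q := by
    filter_upwards [hA1, hpA] with q h1 h2 using g.smoothFieldAt_normalize h1 h2
  have hXp : X p = x := by simp [X, hA1p, hxx]
  have hXX : ∀ᶠ q in 𝓝 p, g.val q (X q) (X q) = 1 := hpA.mono fun q h => g.val_normalize h
  let B2 : VField M := fun q => B1 q - g.val q (X q) (B1 q) • X q
  have hB2 : ∀ᶠ q in 𝓝 p, SmoothFieldAt B2 q := by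
    filter_upwards [hB1, hX] with q h1 h2 using h1.sub (.smul (g.contMDiffAt_val h2 h1) h2)
  have hB2p : B2 p = y := by simp [B2, hB1p, hXp, hxy]
  have hpB : ∀ᶠ q in 𝓝 p, 0 < g.val q (B2 q) (B2 q) :=
    (g.contMDiffAt_val hB2.self_of_nhds hB2.self_of_nhds).continuousAt.eventually
      (lt_mem_nhds (by beta_reduce; rw [hB2p, hyy]; exact one_pos))
  let Y : VField M := fun q => (Real.sqrt (g.val q (B2 q) (B2 q)))⁻¹ • B2 q
  have hY : ∀ᶠ q in 𝓝 p, SmoothFieldAt Y q := by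
    filter_upwards [hB2, hpB] with q h1 h2 using g.smoothFieldAt_normalize h1 h2
  have hYp : Y p = y := by simp [Y, hB2p, hyy]
  have hYY : ∀ᶠ q in 𝓝 p, g.val q (Y q) (Y q) = 1 := hpB.mono fun q h => g.val_normalize h
  have hXY : ∀ᶠ q in 𝓝 p, g.val q (X q) (Y q) = 0 := by
    filter_upwards [hXX] with q h
    simp only [Y, B2, map_smul, map_sub, h, smul_eq_mul, mul_one, sub_self, mul_zero]
  -- Horizontality holds at every `q`, also where the square root or its inverse takes a default
  -- value.
  have hXH : ∀ q, X q ∈ g.horiz k t q := fun q =>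
    Submodule.smul_mem _ _ (g.proj_mem_horiz (hG q) _)
  have hYH : ∀ q, Y q ∈ g.horiz k t q := fun q =>
    Submodule.smul_mem _ _ (Submodule.sub_mem _ (g.proj_mem_horiz (hG q) _)
      (Submodule.smul_mem _ _ (hXH q)))
  -- The bracket hypotheses of admissibility concern globally smooth horizontal fields, so the local
  -- frame is cut off by bump functions; orthonormality survives near `p`.
  obtain ⟨χ, hχ, hχ1⟩ := exists_bump_smul hX
  obtain ⟨η, hη, hη1⟩ := exists_bump_smul hY
  refine ⟨_, _, by simp [hχ1.self_of_nhds, hXp], by simp [hη1.self_of_nhds, hYp], hχ, hη,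
    fun q => Submodule.smul_mem _ _ (hXH q), fun q => Submodule.smul_mem _ _ (hYH q), ?_⟩
  filter_upwards [hχ1, hη1, hXX, hYY, hXY] with q h1 h2 h3 h4 h5
  simp only [h1, h2, one_smul, h3, h4, h5, and_self]

end SemiRiemannianMetric

end Frames

/-! ### Oriented frames, and the smoothness of `J`. -/

section AlmostComplex

variable {M : Type*} [TopologicalSpace M] [ChartedSpace R4 M] [IsManifold (𝓡 4) ∞ M]

/-- Positivity of a continuous frame is an open condition. -/
theorem MOrientation.eventually_isPositive (o : MOrientation M) {e : Fin 4 → VField M} {p : M}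
    (he : ∀ i, SmoothFieldAt (e i) p) (hp : o.IsPositive p fun i => e i p) :
    ∀ᶠ q in 𝓝 p, o.IsPositive q fun i => e i q := by
  obtain ⟨o', ho'⟩ := o.locally_constant p
  obtain ⟨A, hA, hAo⟩ := ho'.self_of_nhds
  obtain ⟨b, hb, hbo⟩ := hp
  let c := b.map A
  have hco : c.orientation = o' := by rw [Module.Basis.orientation_map, hbo, hAo]
  have hcz : ∀ i, c i = chartField p (e i) (extChartAt (𝓡 4) p p) := fun i => by
    rw [Module.Basis.map_apply, hb, hA, toChart_self, chartField_self]
  -- Read in the chart the orientation is constant, so positivity of the frame becomes positivity of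
  -- a determinant, continuous in the point and equal to `1` at the centre.
  have hcont : ContinuousAt (fun y => c.det fun i => chartField p (e i) y)
      (extChartAt (𝓡 4) p p) := by
    simp only [Module.Basis.det_apply]
    refine (Continuous.matrix_det continuous_id).continuousAt.comp ?_
    refine continuousAt_pi.mpr fun i => continuousAt_pi.mpr fun j => ?_
    exact (LinearMap.continuous_of_finiteDimensional (c.coord i)).continuousAt.comp
      (contDiffAt_chartField (he j)).continuousAt
  have hpos : ∀ᶠ y in 𝓝 (extChartAt (𝓡 4) p p), 0 < c.det fun i => chartField p (e i) y := by
    refine hcont.eventually (lt_mem_nhds ?_)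
    simp only [← hcz, Module.Basis.det_self, zero_lt_one]
  filter_upwards [(continuousAt_extChartAt (I := 𝓡 4) p).eventually hpos, ho',
    extChartAt_source_mem_nhds (I := 𝓡 4) p] with q hq ⟨B, hB, hBo⟩ hqs
  obtain ⟨y, hy, rfl⟩ : ∃ y ∈ (extChartAt (𝓡 4) p).target, (extChartAt (𝓡 4) p).symm y = q :=
    ⟨_, (extChartAt (𝓡 4) p).map_source hqs, (extChartAt (𝓡 4) p).left_inv hqs⟩
  rw [(extChartAt (𝓡 4) p).right_inv hy] at hq
  simp only [chartField_eq _ hy, ← hB] at hq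
  have hbas := (Module.Basis.is_basis_iff_det c).mpr hq.ne'.isUnit
  let d := Module.Basis.mk hbas.1 hbas.2.ge
  have hd : ∀ i, d i = B (e i ((extChartAt (𝓡 4) p).symm y)) := fun i => by simp [d]
  have hdo : d.orientation = o' := by
    rw [← hco, eq_comm, Module.Basis.orientation_eq_iff_det_pos,
      show (d : Fin 4 → R4) = _ from funext hd]
    exact hq
  refine ⟨d.map B.symm, fun i => by
    rw [Module.Basis.map_apply, hd]; exact B.symm_apply_apply _, ?_⟩
  apply (Orientation.map (Fin 4) B).injective
  rw [hBo, ← hdo, ← Module.Basis.orientation_map]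
  exact congrArg _ (Module.Basis.eq_of_apply_eq fun i => B.apply_symm_apply (d i))

theorem ball_fin_four {P : Fin 4 → Prop} (h0 : P 0) (h1 : P 1) (h2 : P 2) (h3 : P 3) (i : Fin 4) :
    P i := by
  fin_cases i
  exacts [h0, h1, h2, h3]

namespace SemiRiemannianMetric

/-- Oriented orthonormal frames of `ℋ` extend to smooth ones. -/
theorem IsAdmissible.exists_frame [T2Space M] {g : SemiRiemannianMetric M} {o : MOrientation M}
    {k t : VField M} {τ ℓ : M → ℝ} (hadm : g.IsAdmissible o k t τ ℓ) (p : M) :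
    ∃ X Y : VField M, SmoothFieldOn X univ ∧ SmoothFieldOn Y univ ∧
      (∀ q, X q ∈ g.horiz k t q) ∧ (∀ q, Y q ∈ g.horiz k t q) ∧
      ∀ᶠ q in 𝓝 p, g.IsOrientedFrame o k t q (X q) (Y q) := by
  obtain ⟨x, y, hx, hy, hxx, hyy, hxy, hpos⟩ := g.exists_isOrientedFrame o k t p
    (hadm.linearIndependent p) (hadm.spacelike p)
  obtain ⟨X, Y, rfl, rfl, hX, hY, hXH, hYH, h⟩ := g.exists_smooth_orthonormal hadm.smooth_k
    hadm.smooth_t (fun q => g.gramDet_ne_zero (hadm.linearIndependent q) (hadm.spacelike q))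
    hx hy hxx hyy hxy
  refine ⟨X, Y, hX, hY, hXH, hYH, ?_⟩
  have e : ∀ q, (fun i => (![k, t, X, Y] : Fin 4 → VField M) i q) = ![k q, t q, X q, Y q] :=
    fun q => funext (ball_fin_four rfl rfl rfl rfl)
  have := o.eventually_isPositive (e := ![k, t, X, Y]) (p := p)
    (ball_fin_four (hadm.smooth_k.smoothFieldAt univ_mem) (hadm.smooth_t.smoothFieldAt univ_mem)
      (hX.smoothFieldAt univ_mem) (hY.smoothFieldAt univ_mem)) (by rw [e]; exact hpos)
  filter_upwards [h, this] with q h1 h2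
  rw [e] at h2
  exact ⟨hXH q, hYH q, h1.1, h1.2.1, h1.2.2, h2⟩

theorem IsAdmissible.isJAt_acs {g : SemiRiemannianMetric M} {o : MOrientation M}
    {k t : VField M} {τ ℓ : M → ℝ} (hadm : g.IsAdmissible o k t τ ℓ) (p : M) :
    g.IsJAt o k t p (g.acs o k t p) :=
  Classical.epsilon_spec (g.existsUnique_isJAt o k t p (hadm.linearIndependent p)
    (hadm.spacelike p)).exists

theorem IsAdmissible.acs_frame {g : SemiRiemannianMetric M} {o : MOrientation M}
    {k t : VField M} {τ ℓ : M → ℝ} (hadm : g.IsAdmissible o k t τ ℓ) {p : M} {x y : Tan p}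
    (h : g.IsOrientedFrame o k t p x y) :
    g.acs o k t p x = y ∧ g.acs o k t p y = -x := by
  have hJ := hadm.isJAt_acs p
  have e : g.acs o k t p x = y := j_frame (g.bil p) (k p) (t p) x y (g.symm p)
    (fun v h1 h2 h3 => hadm.spacelike p v ⟨h1, h2⟩ h3) (o.val p) h (g.acs o k t p)
    hJ.map_horiz hJ.sq_horiz hJ.isometry hJ.oriented
  exact ⟨e, by rw [← e, hJ.sq_horiz x h.1]⟩

/-- Expansion of a horizontal vector in an oriented orthonormal frame. -/
theorem IsAdmissible.horiz_expand {g : SemiRiemannianMetric M} {o : MOrientation M}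
    {k t : VField M} {τ ℓ : M → ℝ} (hadm : g.IsAdmissible o k t τ ℓ) {p : M} {x y : Tan p}
    (h : g.IsOrientedFrame o k t p x y) {v : Tan p} (hv : v ∈ g.horiz k t p) :
    v = g.val p v x • x + g.val p v y • y :=
  span_frame (g.bil p) (k p) (t p) x y (g.symm p)
    (fun v h1 h2 h3 => hadm.spacelike p v ⟨h1, h2⟩ h3) (o.val p) h v hv

theorem val_proj (g : SemiRiemannianMetric M) {k t : VField M} {p : M} (v : Tan p) {x : Tan p}
    (hx : x ∈ g.horiz k t p) : g.val p (g.proj k t p v) x = g.val p v x := by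
  rw [g.symm, proj_apply]
  simp only [map_sub, map_smul]
  rw [g.symm p x (k p), g.symm p x (t p), hx.1, hx.2, g.symm p x v]
  simp

/-- Expansion of a vector in a frame `k, t, x, y` adapted to `𝒱 ⊕ ℋ`. -/
theorem IsAdmissible.expand {g : SemiRiemannianMetric M} {o : MOrientation M}
    {k t : VField M} {τ ℓ : M → ℝ} (hadm : g.IsAdmissible o k t τ ℓ) {p : M} {x y : Tan p}
    (h : g.IsOrientedFrame o k t p x y) (v : Tan p) :
    v = (g.val p (t p) (t p) / g.gramDet k t p * g.val p (k p) v
          - g.val p (k p) (t p) / g.gramDet k t p * g.val p (t p) v) • k p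
      + (g.val p (k p) (k p) / g.gramDet k t p * g.val p (t p) v
          - g.val p (k p) (t p) / g.gramDet k t p * g.val p (k p) v) • t p
      + g.val p x v • x + g.val p y v • y := by
  have hG := g.gramDet_ne_zero (hadm.linearIndependent p) (hadm.spacelike p)
  have e := hadm.horiz_expand h (g.proj_mem_horiz hG v)
  rw [g.val_proj v h.1, g.val_proj v h.2.1, proj_apply, g.symm p v x, g.symm p v y] at e
  rw [add_assoc, ← e]
  abel

theorem IsAdmissible.acs_apply {g : SemiRiemannianMetric M} {o : MOrientation M}
    {k t : VField M} {τ ℓ : M → ℝ} (hadm : g.IsAdmissible o k t τ ℓ) {p : M} {x y : Tan p}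
    (h : g.IsOrientedFrame o k t p x y) (v : Tan p) :
    g.acs o k t p v = (g.val p (t p) (t p) / g.gramDet k t p * g.val p (k p) v
          - g.val p (k p) (t p) / g.gramDet k t p * g.val p (t p) v) • t p
      - (g.val p (k p) (k p) / g.gramDet k t p * g.val p (t p) v
          - g.val p (k p) (t p) / g.gramDet k t p * g.val p (k p) v) • k p
      + g.val p x v • y - g.val p y v • x := by
  have hJ := hadm.isJAt_acs p
  nth_rw 1 [hadm.expand h v]
  simp only [map_add, map_smul, hJ.map_k, hJ.map_t, (hadm.acs_frame h).1, (hadm.acs_frame h).2,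
    smul_neg]
  abel

theorem IsAdmissible.acs_sq {g : SemiRiemannianMetric M} {o : MOrientation M}
    {k t : VField M} {τ ℓ : M → ℝ} (hadm : g.IsAdmissible o k t τ ℓ) {p : M} (v : Tan p) :
    g.acs o k t p (g.acs o k t p v) = -v := by
  obtain ⟨x, y, h⟩ := g.exists_isOrientedFrame o k t p (hadm.linearIndependent p)
    (hadm.spacelike p)
  have hJ := hadm.isJAt_acs p
  have e1 := hadm.acs_apply h v
  have e2 := hadm.expand h v
  rw [e1]
  conv_rhs => rw [e2]
  simp only [map_add, map_sub, map_smul, hJ.map_k, hJ.map_t, (hadm.acs_frame h).1,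
    (hadm.acs_frame h).2, smul_neg]
  abel

theorem contDiffAt_inChart (g : SemiRiemannianMetric M) (p : M) :
    ContDiffAt ℝ ∞ (g.inChart p) (extChartAt (𝓡 4) p p) :=
  contMDiffAt_bilin_iff.mp (ContMDiffOn.contMDiffAt g.smooth (x := p) univ_mem)

theorem inChart_chartField_left (g : SemiRiemannianMetric M) (X : VField M) {p : M} {y : R4}
    (hy : y ∈ (extChartAt (𝓡 4) p).target) (v : R4) :
    g.inChart p y (chartField p X y) v =
      g.val ((extChartAt (𝓡 4) p).symm y) (X ((extChartAt (𝓡 4) p).symm y)) (fromChart p y v) :=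
  congrArg (fun u => g.val ((extChartAt (𝓡 4) p).symm y) u (fromChart p y v))
    (fromChart_chartField X hy)

theorem inChart_chartField (g : SemiRiemannianMetric M) (X Y : VField M) {p : M} {y : R4}
    (hy : y ∈ (extChartAt (𝓡 4) p).target) :
    g.inChart p y (chartField p X y) (chartField p Y y) =
      g.val ((extChartAt (𝓡 4) p).symm y) (X ((extChartAt (𝓡 4) p).symm y))
        (Y ((extChartAt (𝓡 4) p).symm y)) := by
  rw [g.inChart_chartField_left X hy, fromChart_chartField Y hy]

/-- `J` is defined by choice at each point, but in a smooth oriented frame `acs_apply` expresses it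
through `g`, `k`, `t` and the frame. -/
theorem IsAdmissible.contDiffAt_acs [T2Space M] {g : SemiRiemannianMetric M} {o : MOrientation M}
    {k t : VField M} {τ ℓ : M → ℝ} (hadm : g.IsAdmissible o k t τ ℓ) (p : M) :
    ContDiffAt ℝ ∞ (chartEndo p (g.acs o k t)) (extChartAt (𝓡 4) p p) := by
  obtain ⟨X, Y, hX, hY, -, -, hF⟩ := hadm.exists_frame p
  have sk := contDiffAt_chartField (hadm.smooth_k.smoothFieldAt (p := p) univ_mem)
  have st := contDiffAt_chartField (hadm.smooth_t.smoothFieldAt (p := p) univ_mem)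
  have sX := contDiffAt_chartField (hX.smoothFieldAt (p := p) univ_mem)
  have sY := contDiffAt_chartField (hY.smoothFieldAt (p := p) univ_mem)
  have sg := g.contDiffAt_inChart p
  have skk := (sg.clm_apply sk).clm_apply sk
  have skt := (sg.clm_apply sk).clm_apply st
  have stt := (sg.clm_apply st).clm_apply st
  have hz := mem_extChartAt_target (I := 𝓡 4) p
  have hG : g.inChart p (extChartAt (𝓡 4) p p) (chartField p k (extChartAt (𝓡 4) p p))
        (chartField p k (extChartAt (𝓡 4) p p)) *
      g.inChart p (extChartAt (𝓡 4) p p) (chartField p t (extChartAt (𝓡 4) p p))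
        (chartField p t (extChartAt (𝓡 4) p p)) -
      g.inChart p (extChartAt (𝓡 4) p p) (chartField p k (extChartAt (𝓡 4) p p))
        (chartField p t (extChartAt (𝓡 4) p p)) ^ 2 ≠ 0 := by
    rw [g.inChart_chartField k k hz, g.inChart_chartField k t hz, g.inChart_chartField t t hz,
      ← gramDet_eq]
    exact g.gramDet_ne_zero (hadm.linearIndependent _) (hadm.spacelike _)
  have sG := (skk.mul stt).sub (skt.pow 2)
  -- Term by term this is the chart version of `acs_apply`.
  have s := ((((((stt.div sG hG).smul (sg.clm_apply sk)).sub
    ((skt.div sG hG).smul (sg.clm_apply st))).smulRight st).sub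
    ((((skk.div sG hG).smul (sg.clm_apply st)).sub
    ((skt.div sG hG).smul (sg.clm_apply sk))).smulRight sk)).add
    ((sg.clm_apply sX).smulRight sY)).sub ((sg.clm_apply sY).smulRight sX)
  refine (contDiffAt_congr ?_).mp s
  filter_upwards [eventually_target p, (tendsto_chart_symm p).eventually hF] with y hy hFy
  ext v : 1
  have e := congrArg (toChart p ((extChartAt (𝓡 4) p).symm y))
    (hadm.acs_apply hFy (fromChart p y v))
  rw [map_sub, map_add, map_sub] at e
  simp only [map_smul, ← chartField_eq _ hy, gramDet_eq] at e
  refine Eq.trans ?_ e.symm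
  simp only [sub_apply, add_apply, Pi.smul_apply', Pi.div_apply, smul_apply, ContinuousLinearMap.smulRight_apply, smul_eq_mul,
    g.inChart_chartField _ _ hy, g.inChart_chartField_left _ hy]

end SemiRiemannianMetric

end AlmostComplex

/-! ### The exterior derivative: independence of the chart, `d² = 0`, and smoothness. -/

section Forms

set_option synthInstance.maxHeartbeats 200000 in
theorem contDiff_flip {E : Type*} [NormedAddCommGroup E] [NormedSpace ℝ E] :
    ContDiff ℝ ∞ (fun B : E →L[ℝ] E →L[ℝ] ℝ => B.flip) := by
  have : IsBoundedLinearMap ℝ (fun B : E →L[ℝ] E →L[ℝ] ℝ => B.flip) :=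
    { map_add := fun _ _ => rfl
      map_smul := fun _ _ => rfl
      bound := ⟨1, one_pos, fun B => by rw [ContinuousLinearMap.opNorm_flip, one_mul]⟩ }
  exact this.contDiff

/-- With `B` the derivative of a one-form `θ`, this is `(v, w) ↦ dθ(v, J w)`, the shape of `g_K` in
a chart. -/
theorem contDiffAt_skew_comp {E : Type*} [NormedAddCommGroup E] [NormedSpace ℝ E]
    {B : E → E →L[ℝ] E →L[ℝ] ℝ} {J : E → E →L[ℝ] E} {z : E} (hB : ContDiffAt ℝ ∞ B z)
    (hJ : ContDiffAt ℝ ∞ J z) :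
    ContDiffAt ℝ ∞ (fun y => ((B y - (B y).flip).flip ∘L J y).flip) z :=
  contDiff_flip.contDiffAt.comp z ((contDiff_flip.contDiffAt.comp z
    (hB.sub (contDiff_flip.contDiffAt.comp z hB))).clm_comp hJ)

variable {M : Type*} [TopologicalSpace M] [ChartedSpace R4 M] [IsManifold (𝓡 4) ∞ M]

set_option linter.unusedSectionVars false

/-- A differential form read in the chart centred at `p`. -/
noncomputable def chartForm {n : ℕ} (p : M) (η : DForm M n) (y : R4) : R4 [⋀^Fin n]→L[ℝ] ℝ :=
  (η ((extChartAt (𝓡 4) p).symm y)).compContinuousLinearMap (fromChart p y)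

theorem chartForm_comp_toChart {n : ℕ} {p q : M} (η : DForm M n)
    (hq : q ∈ (extChartAt (𝓡 4) p).source) :
    (chartForm p η (extChartAt (𝓡 4) p q)).compContinuousLinearMap (toChart p q) = η q := by
  obtain ⟨y, hy, rfl⟩ : ∃ y ∈ (extChartAt (𝓡 4) p).target, (extChartAt (𝓡 4) p).symm y = q :=
    ⟨_, (extChartAt (𝓡 4) p).map_source hq, (extChartAt (𝓡 4) p).left_inv hq⟩
  rw [(extChartAt (𝓡 4) p).right_inv hy]
  ext v
  exact congrArg (η ((extChartAt (𝓡 4) p).symm y)) (funext fun i => fromChart_toChart hy (v i))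

theorem fderiv_chart_comp {p q : M} {y : R4} (hy : y ∈ (extChartAt (𝓡 4) q).target)
    (hyp : (extChartAt (𝓡 4) q).symm y ∈ (extChartAt (𝓡 4) p).source) :
    fderiv ℝ (extChartAt (𝓡 4) p ∘ (extChartAt (𝓡 4) q).symm) y =
      toChart p ((extChartAt (𝓡 4) q).symm y) ∘L fromChart q y := by
  rw [← mfderiv_eq_fderiv]
  have h1 : MDifferentiableAt (𝓡 4) 𝓘(ℝ, R4) (extChartAt (𝓡 4) p)
      ((extChartAt (𝓡 4) q).symm y) := mdifferentiableAt_extChartAt (by simpa using hyp)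
  have h2 : MDifferentiableAt 𝓘(ℝ, R4) (𝓡 4) (extChartAt (𝓡 4) q).symm y := by
    have := mdifferentiableWithinAt_extChartAt_symm hy
    rwa [ModelWithCorners.range_eq_univ, mdifferentiableWithinAt_univ] at this
  exact mfderiv_comp y h1 h2

/-- Two chart readings differ by pullback along the transition map; naturality of the exterior
derivative then applies. -/
theorem chartForm_change {n : ℕ} {p q : M} (η : DForm M n) {y : R4}
    (hy : y ∈ (extChartAt (𝓡 4) q).target)
    (hyp : (extChartAt (𝓡 4) q).symm y ∈ (extChartAt (𝓡 4) p).source) :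
    chartForm q η y =
      (chartForm p η ((extChartAt (𝓡 4) p ∘ (extChartAt (𝓡 4) q).symm) y)).compContinuousLinearMap
        (fderiv ℝ (extChartAt (𝓡 4) p ∘ (extChartAt (𝓡 4) q).symm) y) := by
  rw [fderiv_chart_comp hy hyp, chartForm, ← chartForm_comp_toChart η hyp]
  rfl

theorem minSmoothness_two_le : minSmoothness ℝ 2 ≤ ∞ := by
  rw [minSmoothness_of_isRCLikeNormedField]
  exact WithTop.coe_le_coe.mpr (le_top (a := (2 : ℕ∞)))

/-- The exterior derivative may be computed in any chart. -/
theorem mextDeriv_eq {n : ℕ} {p q : M} (η : DForm M n) (hq : q ∈ (extChartAt (𝓡 4) p).source)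
    (hη : DifferentiableAt ℝ (chartForm p η) (extChartAt (𝓡 4) p q)) :
    mextDeriv η q =
      (extDeriv (chartForm p η) (extChartAt (𝓡 4) p q)).compContinuousLinearMap (toChart p q) := by
  have hT : (extChartAt (𝓡 4) p ∘ (extChartAt (𝓡 4) q).symm) (extChartAt (𝓡 4) q q) =
      extChartAt (𝓡 4) p q := by simp
  have hev : chartForm q η =ᶠ[𝓝 (extChartAt (𝓡 4) q q)] fun y =>
      (chartForm p η ((extChartAt (𝓡 4) p ∘ (extChartAt (𝓡 4) q).symm) y)).compContinuousLinearMap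
        (fderiv ℝ (extChartAt (𝓡 4) p ∘ (extChartAt (𝓡 4) q).symm) y) := by
    filter_upwards [eventually_target q, (tendsto_chart_symm q).eventually
      (extChartAt_source_mem_nhds' (I := 𝓡 4) hq)] with y hy hyp
    exact chartForm_change η hy hyp
  have hTs : ContDiffAt ℝ ∞ (extChartAt (𝓡 4) p ∘ (extChartAt (𝓡 4) q).symm)
      (extChartAt (𝓡 4) q q) := by
    have := contMDiffAt_extChartAt' (I := 𝓡 4) (n := ∞) (x := p) (x' := q) (by simpa using hq)
    exact contMDiffAt_real_iff.mp this
  have h1 : mextDeriv η q = (extDeriv (chartForm q η)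
      (extChartAt (𝓡 4) q q)).compContinuousLinearMap (toChart q q) := rfl
  rw [h1, hev.extDeriv_eq, extDeriv_pullback (r := ∞) (by rw [hT]; exact hη) hTs
    minSmoothness_two_le, hT]
  ext v
  refine congrArg (extDeriv (chartForm p η) (extChartAt (𝓡 4) p q)) (funext fun i => ?_)
  have h2 := fderiv_chart_comp (p := p) (mem_extChartAt_target (I := 𝓡 4) q)
    (by rw [extChartAt_to_inv]; exact hq)
  have h3 := DFunLike.congr_fun h2 (toChart q q (v i))
  refine h3.trans ?_
  have h4 := fromChart_toChart (mem_extChartAt_target (I := 𝓡 4) q)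
  -- The base point is generalised so that the propositional equality `φ⁻¹(φ(q)) = q` can be
  -- eliminated.
  have key : ∀ (q' : M) (A : R4 →L[ℝ] Tan q'), q' = q → (∀ u : R4, (show R4 from A u) = u) →
      ∀ v : Tan q, toChart p q' (A (toChart q q v)) = toChart p q v := by
    rintro q' A rfl hA v
    have : A (toChart q' q' v) = v := (hA _).trans (toChart_self q' v)
    rw [this]
  exact key _ _ (extChartAt_to_inv q) (fromChart_self q) (v i)

/-- `mextDeriv` uses a different chart at every point; here a single chart serves a whole
neighbourhood, so that the result can be differentiated again. -/
theorem chartForm_mextDeriv {n : ℕ} {p : M} (η : DForm M n)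
    (hη : ContDiffAt ℝ ∞ (chartForm p η) (extChartAt (𝓡 4) p p)) :
    chartForm p (mextDeriv η) =ᶠ[𝓝 (extChartAt (𝓡 4) p p)] extDeriv (chartForm p η) := by
  have h1 := (hη.of_le (m := 1) (by simp)).eventually (by simp)
  filter_upwards [eventually_target p, h1] with y hy h2
  have e := (extChartAt (𝓡 4) p).right_inv hy
  rw [chartForm, mextDeriv_eq η ((extChartAt (𝓡 4) p).map_target hy)
    (by rw [e]; exact h2.differentiableAt one_ne_zero), e]
  ext v
  exact congrArg (extDeriv (chartForm p η) y) (funext fun i => toChart_fromChart hy (v i))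

theorem mextDeriv_apply_self {n : ℕ} (p : M) (η : DForm M n) (v : Fin (n + 1) → Tan p) :
    mextDeriv η p v = extDeriv (chartForm p η) (extChartAt (𝓡 4) p p) v :=
  congrArg (extDeriv (chartForm p η) (extChartAt (𝓡 4) p p)) (funext fun i => toChart_self p (v i))

theorem mextDeriv_mextDeriv {n : ℕ} {p : M} (η : DForm M n)
    (hη : ContDiffAt ℝ ∞ (chartForm p η) (extChartAt (𝓡 4) p p)) :
    mextDeriv (mextDeriv η) p = 0 := by
  ext v
  rw [mextDeriv_apply_self, (chartForm_mextDeriv η hη).extDeriv_eq,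
    extDeriv_extDeriv_apply hη minSmoothness_two_le]
  rfl

theorem chartBilin_twisted (η : DForm M 2) (J : (p : M) → Tan p →L[ℝ] Tan p) {p : M} {y : R4}
    (hy : y ∈ (extChartAt (𝓡 4) p).target) (v w : R4) :
    chartBilin p (fun q => twistedBilin (E := R4) (η q) (J q)) y v w =
      chartForm p η y ![v, chartEndo p J y w] := by
  have e1 : chartBilin p (fun q => twistedBilin (E := R4) (η q) (J q)) y v w =
      twistedBilin (E := R4) (η ((extChartAt (𝓡 4) p).symm y)) (J ((extChartAt (𝓡 4) p).symm y))
        (fromChart p y v) (fromChart p y w) := rfl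
  refine e1.trans ((twistedBilin_apply (E := R4) (η ((extChartAt (𝓡 4) p).symm y))
    (J ((extChartAt (𝓡 4) p).symm y)) (fromChart p y v) (fromChart p y w)).trans ?_)
  refine congrArg (η ((extChartAt (𝓡 4) p).symm y)) (funext fun i => ?_)
  fin_cases i
  · rfl
  · exact (fromChart_toChart hy _).symm

namespace SemiRiemannianMetric

/-- `u k^♭` in the chart centred at `p`. -/
noncomputable def chartFlat (g : SemiRiemannianMetric M) (u : M → ℝ) (k : VField M) (p : M)
    (y : R4) : R4 →L[ℝ] ℝ :=
  u ((extChartAt (𝓡 4) p).symm y) • g.inChart p y (chartField p k y)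

theorem chartForm_flatForm (g : SemiRiemannianMetric M) (u : M → ℝ) (k : VField M) {p : M}
    {y : R4} (hy : y ∈ (extChartAt (𝓡 4) p).target) :
    chartForm p (g.flatForm u k) y = flatOneForm (g.chartFlat u k p y) := by
  ext v
  exact congrArg (u ((extChartAt (𝓡 4) p).symm y) * ·) (g.inChart_chartField_left k hy (v 0)).symm

theorem contDiffAt_chartFlat (g : SemiRiemannianMetric M) {u : M → ℝ} {k : VField M} {p : M}
    (hu : ContMDiffAt (𝓡 4) 𝓘(ℝ, ℝ) ∞ u p) (hk : SmoothFieldAt k p) :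
    ContDiffAt ℝ ∞ (g.chartFlat u k p) (extChartAt (𝓡 4) p p) :=
  (contMDiffAt_real_iff.mp hu).smul ((g.contDiffAt_inChart p).clm_apply (contDiffAt_chartField hk))

theorem chartForm_flatForm_eventuallyEq (g : SemiRiemannianMetric M) (u : M → ℝ) (k : VField M)
    (p : M) : chartForm p (g.flatForm u k) =ᶠ[𝓝 (extChartAt (𝓡 4) p p)]
      fun y => flatOneForm (g.chartFlat u k p y) := by
  filter_upwards [eventually_target p] with y hy using g.chartForm_flatForm u k hy

theorem contDiffAt_chartForm_flatForm (g : SemiRiemannianMetric M) {u : M → ℝ} {k : VField M}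
    {p : M} (hu : ContMDiffAt (𝓡 4) 𝓘(ℝ, ℝ) ∞ u p) (hk : SmoothFieldAt k p) :
    ContDiffAt ℝ ∞ (chartForm p (g.flatForm u k)) (extChartAt (𝓡 4) p p) :=
  (contDiffAt_congr (g.chartForm_flatForm_eventuallyEq u k p)).mpr
    (contDiffAt_flatOneForm (g.contDiffAt_chartFlat hu hk))

/-- `d(u k^♭)` in a chart. -/
theorem chartForm_mextDeriv_flatForm (g : SemiRiemannianMetric M) {u : M → ℝ} {k : VField M}
    {p : M} (hu : ContMDiffAt (𝓡 4) 𝓘(ℝ, ℝ) ∞ u p) (hk : SmoothFieldAt k p) :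
    ∀ᶠ y in 𝓝 (extChartAt (𝓡 4) p p), ∀ v w : R4,
      chartForm p (mextDeriv (g.flatForm u k)) y ![v, w] =
        fderiv ℝ (g.chartFlat u k p) y v w - fderiv ℝ (g.chartFlat u k p) y w v := by
  have h1 := ((g.contDiffAt_chartFlat hu hk).of_le (m := 1) (by simp)).eventually (by simp)
  filter_upwards [chartForm_mextDeriv _ (g.contDiffAt_chartForm_flatForm hu hk), h1,
    (g.chartForm_flatForm_eventuallyEq u k p).eventually_nhds] with y h2 h3 h4 v w
  rw [h2, EventuallyEq.extDeriv_eq h4, extDeriv_flatOneForm (h3.differentiableAt one_ne_zero)]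

theorem mextDeriv_flatForm_apply (g : SemiRiemannianMetric M) {u : M → ℝ} {k : VField M}
    {p : M} (hu : ContMDiffAt (𝓡 4) 𝓘(ℝ, ℝ) ∞ u p) (hk : SmoothFieldAt k p) (v w : Tan p) :
    mextDeriv (g.flatForm u k) p ![v, w] =
      fderiv ℝ (g.chartFlat u k p) (extChartAt (𝓡 4) p p) v w -
        fderiv ℝ (g.chartFlat u k p) (extChartAt (𝓡 4) p p) w v := by
  rw [mextDeriv_apply_self, EventuallyEq.extDeriv_eq (g.chartForm_flatForm_eventuallyEq u k p)]
  exact extDeriv_flatOneForm ((g.contDiffAt_chartFlat hu hk).differentiableAt (by simp)) v w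

theorem contMDiffAt_mextDeriv_flatForm (g : SemiRiemannianMetric M) {u : M → ℝ}
    {k X Y : VField M} {p : M} (hu : ContMDiffAt (𝓡 4) 𝓘(ℝ, ℝ) ∞ u p) (hk : SmoothFieldAt k p)
    (hX : SmoothFieldAt X p) (hY : SmoothFieldAt Y p) :
    ContMDiffAt (𝓡 4) 𝓘(ℝ, ℝ) ∞ (fun q => mextDeriv (g.flatForm u k) q ![X q, Y q]) p := by
  rw [contMDiffAt_real_iff]
  have s := (g.contDiffAt_chartFlat hu hk).fderiv_right (m := ∞) (by simp)
  have sX := contDiffAt_chartField hX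
  have sY := contDiffAt_chartField hY
  refine (contDiffAt_congr ?_).mp
    (((s.clm_apply sX).clm_apply sY).sub ((s.clm_apply sY).clm_apply sX))
  filter_upwards [g.chartForm_mextDeriv_flatForm hu hk, eventually_target p] with y h hy
  rw [← h]
  refine congrArg (mextDeriv (g.flatForm u k) ((extChartAt (𝓡 4) p).symm y)) (funext fun i => ?_)
  fin_cases i
  exacts [fromChart_chartField X hy, fromChart_chartField Y hy]

/-- The bilinear form `(v, w) ↦ d(u k^♭)(v, J w)` is smooth. -/
theorem contDiffAt_twisted (g : SemiRiemannianMetric M) {u : M → ℝ} {k : VField M}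
    {p : M} (hu : ContMDiffAt (𝓡 4) 𝓘(ℝ, ℝ) ∞ u p) (hk : SmoothFieldAt k p)
    {J : (p : M) → Tan p →L[ℝ] Tan p}
    (hJ : ContDiffAt ℝ ∞ (chartEndo p J) (extChartAt (𝓡 4) p p)) :
    ContDiffAt ℝ ∞ (chartBilin p fun q =>
      twistedBilin (E := R4) (mextDeriv (g.flatForm u k) q) (J q)) (extChartAt (𝓡 4) p p) := by
  have s := (g.contDiffAt_chartFlat hu hk).fderiv_right (m := ∞) (by simp)
  refine (contDiffAt_congr ?_).mp (contDiffAt_skew_comp s hJ)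
  filter_upwards [g.chartForm_mextDeriv_flatForm hu hk, eventually_target p] with y h hy
  ext v w
  rw [chartBilin_twisted _ _ hy, h]
  rfl

end SemiRiemannianMetric

end Forms

/-! ### Gradient, adjoint and connection at a point, and the Leibniz formula for `ω`. -/

section Values

/-- An injective map from `E` to its dual is bijective by dimension. It ensures that the inverses in
`grad`, `adj` and `nabla` are true inverses and not the default value `0`. -/
theorem isInvertible_of_nondegenerate {E : Type*} [NormedAddCommGroup E] [NormedSpace ℝ E]
    [FiniteDimensional ℝ E] (B : E →L[ℝ] E →L[ℝ] ℝ) (h : ∀ u, (∀ v, B u v = 0) → u = 0) :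
    B.IsInvertible := by
  have hinj : Function.Injective (B : E →ₗ[ℝ] E →L[ℝ] ℝ) :=
    (injective_iff_map_eq_zero _).mpr fun u hu => h u fun v => DFunLike.congr_fun hu v
  have hdim : Module.finrank ℝ E = Module.finrank ℝ (E →L[ℝ] ℝ) := by
    rw [← (LinearMap.toContinuousLinearMap (𝕜 := ℝ) (E := E) (F' := ℝ)).finrank_eq]
    exact (Subspace.dual_finrank_eq (K := ℝ) (V := E)).symm
  exact ⟨(LinearEquiv.ofInjectiveOfFinrankEq _ hinj hdim).toContinuousLinearEquiv, by ext; rfl⟩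

theorem apply_inverse_apply {E : Type*} [NormedAddCommGroup E] [NormedSpace ℝ E]
    {B : E →L[ℝ] E →L[ℝ] ℝ} (h : B.IsInvertible) (T : E →L[ℝ] ℝ) : B (B.inverse T) = T := by
  obtain ⟨e, rfl⟩ := h
  rw [ContinuousLinearMap.inverse_equiv]
  exact e.apply_symm_apply T

/-- Antisymmetrised Leibniz rule: the form is the derivative of `f(τ) κ`, with `a = f'(τ)`, `c =
f(τ)`, `L = dτ` and `A` the derivative of `κ`. -/
theorem smul_add_smulRight_sub_swap {E : Type*} [NormedAddCommGroup E] [NormedSpace ℝ E]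
    (a c : ℝ) (A : E →L[ℝ] E →L[ℝ] ℝ) (L κ : E →L[ℝ] ℝ) (v w : E) :
    (c • A + (a • L).smulRight κ) v w - (c • A + (a • L).smulRight κ) w v =
      a * (L v * κ w - L w * κ v) + c * (A v w - A w v) := by
  simp only [add_apply, smul_apply, ContinuousLinearMap.smulRight_apply, smul_eq_mul]
  ring

variable {M : Type*} [TopologicalSpace M] [ChartedSpace R4 M]

theorem mvfderiv_eq_fderiv {u : M → ℝ} {p : M} (hu : ContMDiffAt (𝓡 4) 𝓘(ℝ, ℝ) ∞ u p)
    (v : Tan p) : mvfderiv (𝓡 4) u p v =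
      fderiv ℝ (fun y => u ((extChartAt (𝓡 4) p).symm y)) (extChartAt (𝓡 4) p p) v := by
  have h := (hu.mdifferentiableAt (by simp)).mfderiv
  rw [ModelWithCorners.range_eq_univ, fderivWithin_univ] at h
  exact DFunLike.congr_fun h v

variable [IsManifold (𝓡 4) ∞ M]

namespace SemiRiemannianMetric

theorem inChart_self (g : SemiRiemannianMetric M) (p : M) (u v : Tan p) :
    g.inChart p (extChartAt (𝓡 4) p p) u v = g.val p u v := by
  have key : ∀ (q : M) (A : R4 →L[ℝ] Tan q), q = p → (∀ u : R4, (show R4 from A u) = u) →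
      ∀ u v : Tan p, g.val q (A u) (A v) = g.val p u v := by
    rintro q A rfl hA u v
    exact congrArg₂ (fun u v => g.val q u v) (hA u) (hA v)
  exact key _ _ (extChartAt_to_inv p) (fromChart_self p) u v

theorem isInvertible_inChart (g : SemiRiemannianMetric M) (p : M) :
    (g.inChart p (extChartAt (𝓡 4) p p)).IsInvertible :=
  isInvertible_of_nondegenerate _ fun u hu => g.nondegenerate p u fun v =>
    (g.inChart_self p u v).symm.trans (hu v)

theorem isInvertible_val (g : SemiRiemannianMetric M) (p : M) :
    (show R4 →L[ℝ] R4 →L[ℝ] ℝ from g.val p).IsInvertible :=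
  isInvertible_of_nondegenerate (E := R4) (g.val p) (g.nondegenerate p)

theorem val_grad (g : SemiRiemannianMetric M) {u : M → ℝ} {p : M}
    (hu : ContMDiffAt (𝓡 4) 𝓘(ℝ, ℝ) ∞ u p) (v : Tan p) :
    g.val p (g.grad u p) v =
      fderiv ℝ (fun y => u ((extChartAt (𝓡 4) p).symm y)) (extChartAt (𝓡 4) p p) v := by
  rw [← mvfderiv_eq_fderiv hu]
  exact DFunLike.congr_fun (apply_inverse_apply (E := R4) (g.isInvertible_val p)
    (mvfderiv (𝓡 4) u p)) v

theorem val_adj (g : SemiRiemannianMetric M) (p : M) (A : Tan p →L[ℝ] Tan p) (u v : Tan p) :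
    g.val p (g.adj p A u) v = g.val p u (A v) :=
  DFunLike.congr_fun (apply_inverse_apply (E := R4) (g.isInvertible_val p) _) v

theorem nabla_apply (g : SemiRiemannianMetric M) (X : VField M) (p : M) (v : Tan p) :
    g.nabla X p v =
      flatNabla (g.inChart p) (chartField p X) (extChartAt (𝓡 4) p p) v := by
  have h : (toChart p p).inverse = ContinuousLinearMap.id ℝ (Tan p) :=
    ContinuousLinearMap.inverse_eq (ContinuousLinearMap.ext (toChart_self p))
      (ContinuousLinearMap.ext (toChart_self p))
  have h1 : g.nabla X p v = (toChart p p).inverse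
    (flatNabla (g.inChart p) (chartField p X) (extChartAt (𝓡 4) p p) (toChart p p v)) := rfl
  rw [h1, h, toChart_self]
  rfl

theorem inChart_symm (g : SemiRiemannianMetric M) (p : M) (y u v : R4) :
    g.inChart p y u v = g.inChart p y v u :=
  g.symm _ _ _

theorem chartFlat_one (g : SemiRiemannianMetric M) (k : VField M) (p : M) :
    g.chartFlat (fun _ => 1) k p = fun y => g.inChart p y (chartField p k y) :=
  funext fun _ => one_smul _ _

/-- `dk^♭` is the antisymmetrised covariant derivative of `k`. -/
theorem mextDeriv_flat_eq_nabla (g : SemiRiemannianMetric M) {k : VField M} {p : M}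
    (hk : SmoothFieldAt k p) (v w : Tan p) :
    mextDeriv (g.flatForm (fun _ => 1) k) p ![v, w] =
      g.val p (g.nabla k p v) w - g.val p (g.nabla k p w) v := by
  rw [g.mextDeriv_flatForm_apply contMDiffAt_const hk, g.chartFlat_one, nabla_apply, nabla_apply]
  refine (flatNabla_sub_swap ((g.contDiffAt_inChart p).differentiableAt (by simp))
    (.of_forall fun y => g.inChart_symm p y) (g.isInvertible_inChart p)
    ((contDiffAt_chartField hk).differentiableAt (by simp)) v w).trans ?_
  exact congrArg₂ (· - ·) (g.inChart_self p _ _) (g.inChart_self p _ _)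

/-- `d(f(τ) k^♭) = f'(τ) dτ ∧ k^♭ + f(τ) dk^♭`. -/
theorem omega_apply (g : SemiRiemannianMetric M) {k : VField M} {τ : M → ℝ} {f : ℝ → ℝ} {p : M}
    (hk : SmoothFieldAt k p) (hτ : ContMDiffAt (𝓡 4) 𝓘(ℝ, ℝ) ∞ τ p)
    (hf : ContDiffAt ℝ ∞ f (τ p)) (v w : Tan p) :
    g.omega k τ f p ![v, w] =
      deriv f (τ p) * (g.val p (g.grad τ p) v * g.val p (k p) w
        - g.val p (g.grad τ p) w * g.val p (k p) v)
      + f (τ p) * mextDeriv (g.flatForm (fun _ => 1) k) p ![v, w] := by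
  have hft : ContMDiffAt (𝓡 4) 𝓘(ℝ, ℝ) ∞ (fun q => f (τ q)) p := hf.contMDiffAt.comp p hτ
  have sτ := (contMDiffAt_real_iff.mp hτ).differentiableAt (by simp)
  have hz : τ ((extChartAt (𝓡 4) p).symm (extChartAt (𝓡 4) p p)) = τ p := by rw [extChartAt_to_inv]
  have sf : HasDerivAt f (deriv f (τ p))
      (τ ((extChartAt (𝓡 4) p).symm (extChartAt (𝓡 4) p p))) := by
    rw [hz]; exact (hf.differentiableAt (by simp)).hasDerivAt
  have h1 := HasDerivAt.comp_hasFDerivAt (f := fun y => τ ((extChartAt (𝓡 4) p).symm y)) _ sf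
    sτ.hasFDerivAt
  have sκ := ((g.contDiffAt_inChart p).clm_apply (contDiffAt_chartField hk)).differentiableAt
    (by simp)
  have h2 : HasFDerivAt (g.chartFlat (fun q => f (τ q)) k p) _ (extChartAt (𝓡 4) p p) :=
    h1.smul sκ.hasFDerivAt
  have hkz : ∀ v : Tan p, g.inChart p (extChartAt (𝓡 4) p p)
      (chartField p k (extChartAt (𝓡 4) p p)) v = g.val p (k p) v := fun v => by
    rw [chartField_self]; exact g.inChart_self p _ _
  rw [omega, g.mextDeriv_flatForm_apply hft hk, g.mextDeriv_flatForm_apply contMDiffAt_const hk,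
    g.chartFlat_one, h2.fderiv, g.val_grad hτ, g.val_grad hτ]
  rw [← hkz v, ← hkz w]
  refine (smul_add_smulRight_sub_swap (E := R4) _ _ _ _ _ v w).trans ?_
  rw [Function.comp_apply, hz]

end SemiRiemannianMetric

end Values

/-! ### Block structure of `ω` on `𝒱 ⊕ ℋ`, and the region of positivity. -/

section Values

theorem twoForm_swap {E : Type*} [NormedAddCommGroup E] [NormedSpace ℝ E]
    (η : E [⋀^Fin 2]→L[ℝ] ℝ) (u v : E) : η ![v, u] = -η ![u, v] := by
  have h := η.map_swap ![u, v] (i := 0) (j := 1) (by simp)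
  refine Eq.trans (congrArg η (funext fun i => ?_)) h
  fin_cases i <;> rfl

/-- `η(u, J v) = η(J u, J J v) = -η(J u, v) = η(v, J u)`. -/
theorem twoForm_apply_map_symm {E : Type*} [NormedAddCommGroup E] [NormedSpace ℝ E]
    {η : E [⋀^Fin 2]→L[ℝ] ℝ} {J : E →L[ℝ] E} (hη : ∀ u v, η ![J u, J v] = η ![u, v])
    (hJ : ∀ u, J (J u) = -u) (u v : E) : η ![u, J v] = η ![v, J u] := by
  have h : η ![J u, -v] = -η ![J u, v] := by
    have hB : ∀ w, η ![J u, w] = twistedBilin η (ContinuousLinearMap.id ℝ E) (J u) w := fun w =>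
      (twistedBilin_apply η (ContinuousLinearMap.id ℝ E) (J u) w).symm
    rw [hB, hB, map_neg]
  rw [← hη, hJ, h, twoForm_swap η v (J u), neg_neg]

section Split

variable {E : Type*} [NormedAddCommGroup E] [NormedSpace ℝ E]
  {η : E [⋀^Fin 2]→L[ℝ] ℝ} {J : E →L[ℝ] E} {k t x y : E}

/-- Without mixed values, `η` is a sum of multiples of the area forms of the two planes. -/
theorem twoForm_split (hkx : η ![k, x] = 0) (hky : η ![k, y] = 0) (htx : η ![t, x] = 0)
    (hty : η ![t, y] = 0) (a b c d a' b' c' d' : ℝ) :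
    η ![a • k + b • t + c • x + d • y, a' • k + b' • t + c' • x + d' • y] =
      (a * b' - b * a') * η ![k, t] + (c * d' - d * c') * η ![x, y] := by
  have hself : ∀ u, η ![u, u] = 0 := fun u =>
    η.map_eq_zero_of_eq _ (i := 0) (j := 1) rfl (by simp)
  have e1 := twoForm_swap η k t
  have e2 := twoForm_swap η x y
  have e3 := twoForm_swap η k x
  have e4 := twoForm_swap η k y
  have e5 := twoForm_swap η t x
  have e6 := twoForm_swap η t y
  have hB : ∀ u v, η ![u, v] = twistedBilin η (ContinuousLinearMap.id ℝ E) u v := fun u v =>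
    (twistedBilin_apply η (ContinuousLinearMap.id ℝ E) u v).symm
  simp only [hB] at *
  simp only [map_add, map_smul, add_apply, smul_apply, smul_eq_mul, e1, e2, e3, e4, e5, e6, hkx,
    hky, htx, hty, hself]
  ring

/-- `J` is a quarter turn in each plane and so preserves both `2 × 2` determinants. -/
theorem twoForm_apply_map_map (hkx : η ![k, x] = 0) (hky : η ![k, y] = 0) (htx : η ![t, x] = 0)
    (hty : η ![t, y] = 0) (hk : J k = t) (ht : J t = -k) (hx : J x = y) (hy : J y = -x)
    (hspan : ∀ u, ∃ a b c d : ℝ, u = a • k + b • t + c • x + d • y) (u v : E) :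
    η ![J u, J v] = η ![u, v] := by
  have hJ : ∀ a b c d : ℝ, J (a • k + b • t + c • x + d • y) =
      (-b) • k + a • t + (-d) • x + c • y := fun a b c d => by
    simp only [map_add, map_smul, hk, ht, hx, hy]; module
  obtain ⟨a, b, c, d, rfl⟩ := hspan u
  obtain ⟨a', b', c', d', rfl⟩ := hspan v
  rw [hJ, hJ, twoForm_split hkx hky htx hty, twoForm_split hkx hky htx hty]
  ring

/-- In coordinates `η(u, J u) = (a² + b²) η(k, t) + (c² + d²) η(x, y)`. -/
theorem twoForm_apply_map_pos (hkx : η ![k, x] = 0) (hky : η ![k, y] = 0) (htx : η ![t, x] = 0)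
    (hty : η ![t, y] = 0) (hk : J k = t) (ht : J t = -k) (hx : J x = y) (hy : J y = -x)
    (hspan : ∀ u, ∃ a b c d : ℝ, u = a • k + b • t + c • x + d • y)
    (hkt : 0 < η ![k, t]) (hxy : 0 < η ![x, y]) {u : E} (hu : u ≠ 0) : 0 < η ![u, J u] := by
  have hJ : ∀ a b c d : ℝ, J (a • k + b • t + c • x + d • y) =
      (-b) • k + a • t + (-d) • x + c • y := fun a b c d => by
    simp only [map_add, map_smul, hk, ht, hx, hy]; module
  obtain ⟨a, b, c, d, rfl⟩ := hspan u
  rw [hJ, twoForm_split hkx hky htx hty]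
  by_contra! h
  have h1 : a ^ 2 + b ^ 2 ≤ 0 := by nlinarith [sq_nonneg a, sq_nonneg b, sq_nonneg c, sq_nonneg d]
  have h2 : c ^ 2 + d ^ 2 ≤ 0 := by nlinarith [sq_nonneg a, sq_nonneg b, sq_nonneg c, sq_nonneg d]
  have ha : a = 0 := by nlinarith [sq_nonneg a, sq_nonneg b]
  have hb : b = 0 := by nlinarith [sq_nonneg a, sq_nonneg b]
  have hc : c = 0 := by nlinarith [sq_nonneg c, sq_nonneg d]
  have hd : d = 0 := by nlinarith [sq_nonneg c, sq_nonneg d]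
  simp [ha, hb, hc, hd] at hu

end Split

namespace SemiRiemannianMetric

variable {M : Type*} [TopologicalSpace M] [ChartedSpace R4 M] [IsManifold (𝓡 4) ∞ M]
  {g : SemiRiemannianMetric M} {o : MOrientation M} {k t : VField M} {τ ℓ : M → ℝ}

theorem IsAdmissible.ell_ne_zero (hadm : g.IsAdmissible o k t τ ℓ) (p : M) : ℓ p ≠ 0 := fun h => by
  have h1 := (hadm.linearIndependent p).ne_zero 1
  exact h1 ((hadm.t_eq p).trans (by rw [h, zero_smul]))

theorem IsAdmissible.val_grad_τ (hadm : g.IsAdmissible o k t τ ℓ) (p : M) (v : Tan p) :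
    g.val p (g.grad τ p) v = g.val p (t p) v / ℓ p := by
  have h : g.val p (t p) v = ℓ p * g.val p (g.grad τ p) v := by
    have := hadm.t_eq p
    generalize g.grad τ p = w at *
    rw [this, map_smul]
    rfl
  rw [h, mul_div_cancel_left₀ _ (hadm.ell_ne_zero p)]

/-- As `t` has no zeros, `dτ ≠ 0` and `τ` is open. Smoothness of `f` on the range thus becomes
smoothness at each `τ p`, and `deriv f` there is the true derivative. -/
theorem IsAdmissible.range_mem_nhds (hadm : g.IsAdmissible o k t τ ℓ) (p : M) :
    range τ ∈ 𝓝 (τ p) := by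
  have hs := (contMDiffAt_real_iff.mp (hadm.smooth_τ p)).hasStrictFDerivAt (by simp)
  have hsurj := hs.map_nhds_eq_of_surj <| by
    refine LinearMap.range_eq_top.mpr (LinearMap.surjective fun h0 => ?_)
    refine (hadm.linearIndependent p).ne_zero 1 (g.nondegenerate p _ fun v => ?_)
    have h1 : g.val p (g.grad τ p) v = 0 :=
      (g.val_grad (hadm.smooth_τ p) v).trans (DFunLike.congr_fun h0 v)
    rw [hadm.val_grad_τ, div_eq_zero_iff] at h1
    exact h1.resolve_right (hadm.ell_ne_zero p)
  have hz : τ ((extChartAt (𝓡 4) p).symm (extChartAt (𝓡 4) p p)) = τ p := by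
    rw [extChartAt_to_inv]
  rw [hz] at hsurj
  rw [← hsurj, mem_map]
  exact univ_mem' fun y => mem_range_self _

theorem apply_eq_zero_of_grad_mem_vert (g : SemiRiemannianMetric M) {u : M → ℝ} {p : M}
    (hu : ContMDiffAt (𝓡 4) 𝓘(ℝ, ℝ) ∞ u p) (h : g.grad u p ∈ vert k t p) {x : Tan p}
    (hx : x ∈ g.horiz k t p) :
    fderiv ℝ (fun y => u ((extChartAt (𝓡 4) p).symm y)) (extChartAt (𝓡 4) p p) x = 0 := by
  rw [← g.val_grad hu]
  obtain ⟨a, b, hab⟩ := Submodule.mem_span_pair.mp h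
  rw [← hab, map_add, map_smul, map_smul]
  have := hx.1
  have := hx.2
  simp_all

/-- `dk^♭(K, X) = 0` when `X` is orthogonal to `k`, `[K, X]` is orthogonal to `k` and the gradient
of `g(k, K)` is orthogonal to `X`. -/
theorem mextDeriv_flat_eq_zero (g : SemiRiemannianMetric M) {K X : VField M} {p : M}
    (hk : SmoothFieldAt k p) (hK : SmoothFieldAt K p) (hX : SmoothFieldAt X p)
    (hkX : ∀ᶠ q in 𝓝 p, g.val q (k q) (X q) = 0)
    (hbr : g.val p (k p) (mlieBracket (𝓡 4) K X p) = 0)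
    (hd : fderiv ℝ (fun y => g.val ((extChartAt (𝓡 4) p).symm y)
      (k ((extChartAt (𝓡 4) p).symm y)) (K ((extChartAt (𝓡 4) p).symm y)))
      (extChartAt (𝓡 4) p p) (X p) = 0) :
    mextDeriv (g.flatForm (fun _ => 1) k) p ![K p, X p] = 0 := by
  have sκ := ((g.contDiffAt_inChart p).clm_apply (contDiffAt_chartField hk)).differentiableAt
    (by simp)
  rw [g.mextDeriv_flatForm_apply contMDiffAt_const hk, g.chartFlat_one]
  have key := fderiv_sub_swap_of_apply_eq_zero sκ
    ((contDiffAt_chartField hK).differentiableAt (by simp))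
    ((contDiffAt_chartField hX).differentiableAt (by simp)) <| by
      filter_upwards [eventually_target p, (tendsto_chart_symm p).eventually hkX] with y hy h
      rw [g.inChart_chartField k X hy, h]
  have e1 : (fun y => g.inChart p y (chartField p k y) (chartField p K y)) =ᶠ[
      𝓝 (extChartAt (𝓡 4) p p)] fun y => g.val ((extChartAt (𝓡 4) p).symm y)
      (k ((extChartAt (𝓡 4) p).symm y)) (K ((extChartAt (𝓡 4) p).symm y)) := by
    filter_upwards [eventually_target p] with y hy
    exact g.inChart_chartField k K hy
  rw [e1.fderiv_eq, chartField_self p X, chartField_self p K, chartField_self p k] at key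
  refine key.trans ?_
  have e2 := (g.inChart_self p (k p) (mlieBracket (𝓡 4) K X p)).trans hbr
  rw [mlieBracket_eq] at e2
  rw [sub_eq_zero, neg_eq_zero.mpr hd]
  exact e2.symm

/-- The bracket and gradient hypotheses combine here: one instance of Cartan's formula for `k`, with
`g(k, k)`, and one for `t`, with `g(k, t)`. -/
theorem IsAdmissible.mextDeriv_flat_horiz (hadm : g.IsAdmissible o k t τ ℓ) {X : VField M}
    (hX : SmoothFieldOn X univ) (hXh : ∀ q, X q ∈ g.horiz k t q) (p : M) :
    mextDeriv (g.flatForm (fun _ => 1) k) p ![k p, X p] = 0 ∧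
      mextDeriv (g.flatForm (fun _ => 1) k) p ![t p, X p] = 0 := by
  have sk := hadm.smooth_k.smoothFieldAt (p := p) univ_mem
  have st := hadm.smooth_t.smoothFieldAt (p := p) univ_mem
  have sX := hX.smoothFieldAt (p := p) univ_mem
  exact ⟨g.mextDeriv_flat_eq_zero sk sk sX (.of_forall fun q => (hXh q).1)
      (hadm.bracket_k X hX hXh p).1
      (g.apply_eq_zero_of_grad_mem_vert (g.contMDiffAt_val sk sk) (hadm.grad_kk p) (hXh p)),
    g.mextDeriv_flat_eq_zero sk st sX (.of_forall fun q => (hXh q).1)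
      (hadm.bracket_t X hX hXh p).1
      (g.apply_eq_zero_of_grad_mem_vert (g.contMDiffAt_val sk st) (hadm.grad_kt p) (hXh p))⟩

theorem IsAdmissible.omega_horiz (hadm : g.IsAdmissible o k t τ ℓ) {f : ℝ → ℝ}
    (hf : ContDiffOn ℝ ∞ f (range τ)) {X : VField M}
    (hX : SmoothFieldOn X univ) (hXh : ∀ q, X q ∈ g.horiz k t q) (p : M) :
    g.omega k τ f p ![k p, X p] = 0 ∧ g.omega k τ f p ![t p, X p] = 0 := by
  have sk := hadm.smooth_k.smoothFieldAt (p := p) univ_mem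
  have hfp := hf.contDiffAt (hadm.range_mem_nhds p)
  obtain ⟨h1, h2⟩ := hadm.mextDeriv_flat_horiz hX hXh p
  rw [g.omega_apply sk (hadm.smooth_τ p) hfp, g.omega_apply sk (hadm.smooth_τ p) hfp, h1, h2]
  simp only [hadm.val_grad_τ, (hXh p).1, (hXh p).2]
  simp

/-- On `ℋ` the term `dτ ∧ k^♭` vanishes, and `dk^♭(x, y) = g(∇_x k, y) - g(∇_y k, x) = -ι`. -/
theorem IsAdmissible.omega_frame (hadm : g.IsAdmissible o k t τ ℓ) {f : ℝ → ℝ}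
    (hf : ContDiffOn ℝ ∞ f (range τ)) {p : M} {x y : Tan p}
    (h : g.IsOrientedFrame o k t p x y) :
    g.omega k τ f p ![x, y] = -(f (τ p) * g.twist o k t p) := by
  have sk := hadm.smooth_k.smoothFieldAt (p := p) univ_mem
  have hfp := hf.contDiffAt (hadm.range_mem_nhds p)
  rw [g.omega_apply sk (hadm.smooth_τ p) hfp, g.mextDeriv_flat_eq_nabla sk,
    g.twist_eq o k t p (hadm.linearIndependent p) (hadm.spacelike p) x y h]
  simp only [hadm.val_grad_τ, h.1.2, h.2.1.2]
  ring

/-- `(dτ ∧ k^♭)(k, t) = (g(k, t)² - g(k, k) g(t, t))/ℓ = -G/ℓ`. -/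
theorem IsAdmissible.omega_vert (hadm : g.IsAdmissible o k t τ ℓ) {f : ℝ → ℝ}
    (hf : ContDiffOn ℝ ∞ f (range τ)) (p : M) :
    g.omega k τ f p ![k p, t p] = -(deriv f (τ p) * g.gramDet k t p / ℓ p
      - f (τ p) * mextDeriv (g.flatForm (fun _ => 1) k) p ![k p, t p]) := by
  have sk := hadm.smooth_k.smoothFieldAt (p := p) univ_mem
  have hfp := hf.contDiffAt (hadm.range_mem_nhds p)
  rw [g.omega_apply sk (hadm.smooth_τ p) hfp, g.gramDet_eq]
  simp only [hadm.val_grad_τ, g.symm p (t p) (k p)]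
  ring

theorem IsAdmissible.mem_region_iff (hadm : g.IsAdmissible o k t τ ℓ) {f : ℝ → ℝ}
    (hf : ContDiffOn ℝ ∞ f (range τ)) {p : M} {x y : Tan p}
    (h : g.IsOrientedFrame o k t p x y) :
    p ∈ g.region o k t τ ℓ f ↔
      0 < g.omega k τ f p ![x, y] ∧ 0 < g.omega k τ f p ![k p, t p] := by
  rw [hadm.omega_frame hf h, hadm.omega_vert hf, neg_pos, neg_pos]
  rfl

theorem IsAdmissible.isOpen_region [T2Space M] (hadm : g.IsAdmissible o k t τ ℓ) {f : ℝ → ℝ}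
    (hf : ContDiffOn ℝ ∞ f (range τ)) : IsOpen (g.region o k t τ ℓ f) := by
  rw [isOpen_iff_mem_nhds]
  intro p hp
  obtain ⟨X, Y, hX, hY, -, -, hXY⟩ := hadm.exists_frame p
  have sk := hadm.smooth_k.smoothFieldAt (p := p) univ_mem
  have st := hadm.smooth_t.smoothFieldAt (p := p) univ_mem
  have sX := hX.smoothFieldAt (p := p) univ_mem
  have sY := hY.smoothFieldAt (p := p) univ_mem
  have sf : ContMDiffAt (𝓡 4) 𝓘(ℝ, ℝ) ∞ (fun q => f (τ q)) p :=
    (hf.contDiffAt (hadm.range_mem_nhds p)).contMDiffAt.comp p (hadm.smooth_τ p)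
  have h := (hadm.mem_region_iff hf hXY.self_of_nhds).mp hp
  filter_upwards [hXY,
    (g.contMDiffAt_mextDeriv_flatForm sf sk sX sY).continuousAt.eventually (lt_mem_nhds h.1),
    (g.contMDiffAt_mextDeriv_flatForm sf sk sk st).continuousAt.eventually (lt_mem_nhds h.2)]
    with q h1 h2 h3
  exact (hadm.mem_region_iff hf h1).mpr ⟨h2, h3⟩

end SemiRiemannianMetric

end Values

/-! ### The shear condition in an oriented orthonormal frame. -/

section Shear

variable {M : Type*} [TopologicalSpace M] [ChartedSpace R4 M] [IsManifold (𝓡 4) ∞ M]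
  {g : SemiRiemannianMetric M} {o : MOrientation M} {k t : VField M} {τ ℓ : M → ℝ}

namespace SemiRiemannianMetric

theorem IsAdmissible.gramDet_ne_zero (hadm : g.IsAdmissible o k t τ ℓ) (p : M) :
    g.gramDet k t p ≠ 0 :=
  g.gramDet_ne_zero (hadm.linearIndependent p) (hadm.spacelike p)

theorem IsAdmissible.proj_vert (hadm : g.IsAdmissible o k t τ ℓ) {p : M} {x y : Tan p}
    (h : g.IsOrientedFrame o k t p x y) : g.proj k t p (k p) = 0 ∧ g.proj k t p (t p) = 0 := by
  have hG := hadm.gramDet_ne_zero p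
  constructor
  · rw [hadm.horiz_expand h (g.proj_mem_horiz hG (k p)), g.val_proj _ h.1, g.val_proj _ h.2.1,
      h.1.1, h.2.1.1, zero_smul, zero_smul, add_zero]
  · rw [hadm.horiz_expand h (g.proj_mem_horiz hG (t p)), g.val_proj _ h.1, g.val_proj _ h.2.1,
      h.1.2, h.2.1.2, zero_smul, zero_smul, add_zero]

theorem trace_eq_of_basis {E : Type*} [AddCommGroup E] [Module ℝ E] {k t x y : E}
    {b : Module.Basis (Fin 4) ℝ E} (hb : ∀ i, b i = ![k, t, x, y] i) {A : E →ₗ[ℝ] E}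
    (hk : A k = 0) (ht : A t = 0) {a c d e : ℝ} (hx : A x = a • x + c • y)
    (hy : A y = d • x + e • y) : LinearMap.trace ℝ E A = a + e := by
  have h0 : b 0 = k := hb 0
  have h1 : b 1 = t := hb 1
  have h2 : b 2 = x := hb 2
  have h3 : b 3 = y := hb 3
  rw [LinearMap.trace_eq_matrix_trace ℝ b, Matrix.trace, Fin.sum_univ_four]
  simp only [Matrix.diag_apply, LinearMap.toMatrix_apply, h0, h1, h2, h3, hk, ht, hx, hy]
  rw [← h2, ← h3]
  simp

/-- The operator is zero on `𝒱`, so its trace over the tangent space is the trace over `ℋ`; the rest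
is the trace-free symmetric part of a `2 × 2` matrix. -/
theorem IsAdmissible.val_shear (hadm : g.IsAdmissible o k t τ ℓ) (X : VField M) {p : M}
    {x y : Tan p} (h : g.IsOrientedFrame o k t p x y) :
    g.val p (g.shear k t X p x) x =
        1 / 2 * (g.val p (g.nabla X p x) x - g.val p (g.nabla X p y) y) ∧
      g.val p (g.shear k t X p x) y =
        1 / 2 * (g.val p (g.nabla X p x) y + g.val p (g.nabla X p y) x) := by
  obtain ⟨hx, hy, hxx, hyy, hxy, b, hb, -⟩ := id h
  obtain ⟨hPk, hPt⟩ := hadm.proj_vert h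
  have hPx := g.proj_of_mem_horiz hx
  have hPy := g.proj_of_mem_horiz hy
  set A : Tan p →L[ℝ] Tan p := g.proj k t p ∘L g.nabla X p ∘L g.proj k t p with hA
  have hAv : ∀ v, A v = g.proj k t p (g.nabla X p (g.proj k t p v)) := fun v => rfl
  have hAk : A (k p) = 0 := by rw [hAv, hPk, map_zero, map_zero]
  have hAt : A (t p) = 0 := by rw [hAv, hPt, map_zero, map_zero]
  have hAx : A x = g.proj k t p (g.nabla X p x) := by rw [hAv, hPx]
  have hAy : A y = g.proj k t p (g.nabla X p y) := by rw [hAv, hPy]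
  have hG := hadm.gramDet_ne_zero p
  have hgx : ∀ u, g.val p (g.proj k t p u) x = g.val p u x := fun u => g.val_proj u hx
  have hgy : ∀ u, g.val p (g.proj k t p u) y = g.val p u y := fun u => g.val_proj u hy
  have htr := trace_eq_of_basis (A := (A : Tan p →ₗ[ℝ] Tan p)) hb hAk hAt
    (hAx.trans (hadm.horiz_expand h (g.proj_mem_horiz hG _)))
    (hAy.trans (hadm.horiz_expand h (g.proj_mem_horiz hG _)))
  rw [hgx, hgy] at htr
  have hs : g.shear k t X p x = (1 / 2 : ℝ) • (A x + g.adj p A x) -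
      ((1 / 2 : ℝ) * LinearMap.trace ℝ (Tan p) (A : Tan p →ₗ[ℝ] Tan p)) • g.proj k t p x := rfl
  have hval : ∀ w, g.val p (g.shear k t X p x) w = 1 / 2 * (g.val p (A x) w + g.val p x (A w)) -
      1 / 2 * (g.val p (g.nabla X p x) x + g.val p (g.nabla X p y) y) * g.val p x w := fun w => by
    rw [hs, htr, hPx, ← g.val_adj]
    simp
    ring
  rw [hval, hval, g.symm p x (A x), g.symm p x (A y), hAx, hAy, hgx, hgy, hgx, hxx, hxy]
  constructor <;> ring

theorem IsAdmissible.val_acs (hadm : g.IsAdmissible o k t τ ℓ) {p : M} {x y : Tan p}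
    (h : g.IsOrientedFrame o k t p x y) (v : Tan p) :
    g.val p (g.acs o k t p v) y = g.val p v x ∧ g.val p (g.acs o k t p v) x = -g.val p v y := by
  rw [hadm.acs_apply h v, g.symm p v x, g.symm p v y]
  obtain ⟨hx, hy, hxx, hyy, hxy, -⟩ := h
  simp [hx.1, hx.2, hy.1, hy.2, hxx, hyy, hxy, g.symm p y x]

/-- The `y`- and `x`-components of `J ∇^o k x = ∇^o t x`, in the shape that `flatNijenhuis_frame`
needs. -/
theorem IsAdmissible.nabla_frame (hadm : g.IsAdmissible o k t τ ℓ) {p : M} {x y : Tan p}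
    (h : g.IsOrientedFrame o k t p x y) :
    g.val p (g.nabla k p x) x - g.val p (g.nabla k p y) y =
        g.val p (g.nabla t p x) y + g.val p (g.nabla t p y) x ∧
      g.val p (g.nabla t p x) x - g.val p (g.nabla t p y) y =
        -(g.val p (g.nabla k p x) y + g.val p (g.nabla k p y) x) := by
  have hJ := hadm.shear_eq p x h.1
  rw [show (fun q => g.acs o k t q (k q)) = t from funext fun q => (hadm.isJAt_acs q).map_k] at hJ
  obtain ⟨h1, h2⟩ := hadm.val_acs h (g.shear k t k p x)
  obtain ⟨h3, h4⟩ := hadm.val_shear k h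
  obtain ⟨h5, h6⟩ := hadm.val_shear t h
  rw [hJ] at h1 h2
  constructor <;> linarith

end SemiRiemannianMetric

end Shear

/-! ### Vanishing of the Nijenhuis tensor. -/

section Integrability

variable {M : Type*} [TopologicalSpace M] [ChartedSpace R4 M] [IsManifold (𝓡 4) ∞ M]
  {g : SemiRiemannianMetric M} {o : MOrientation M} {k t : VField M} {τ ℓ : M → ℝ}

theorem chartEndo_chartField (J : (p : M) → Tan p →L[ℝ] Tan p) (X : VField M) {p : M} {y : R4}
    (hy : y ∈ (extChartAt (𝓡 4) p).target) :
    chartEndo p J y (chartField p X y) = chartField p (fun q => J q (X q)) y := by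
  rw [chartField_eq (fun q => J q (X q)) hy]
  exact congrArg (fun v => toChart p _ (J _ v)) (fromChart_chartField X hy)

theorem eventually_chartEndo_chartField (J : (p : M) → Tan p →L[ℝ] Tan p) (X : VField M) (p : M) :
    chartField p (fun q => J q (X q)) =ᶠ[𝓝 (extChartAt (𝓡 4) p p)]
      fun y => chartEndo p J y (chartField p X y) := by
  filter_upwards [eventually_target p] with y hy
  exact (chartEndo_chartField J X hy).symm

theorem chartEndo_self (J : (p : M) → Tan p →L[ℝ] Tan p) (p : M) (v : Tan p) :
    chartEndo p J (extChartAt (𝓡 4) p p) v = J p v := by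
  -- Any field with value `v` at `p` would do, since no smoothness is required; all tangent spaces
  -- are the same type `R4`.
  have h := chartEndo_chartField J (fun q => (show Tan q from v)) (mem_extChartAt_target (I := 𝓡 4) p)
  rw [chartField_self, chartField_self] at h
  exact h

theorem chartEndo_sq {J : (p : M) → Tan p →L[ℝ] Tan p} (hJ : ∀ q (v : Tan q), J q (J q v) = -v)
    {p : M} {y : R4} (hy : y ∈ (extChartAt (𝓡 4) p).target) (u : R4) :
    chartEndo p J y (chartEndo p J y u) = -u := by
  have h1 : fromChart p y (chartEndo p J y u) = J _ (fromChart p y u) := fromChart_toChart hy _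
  have h2 : chartEndo p J y (chartEndo p J y u) =
    toChart p _ (J _ (fromChart p y (chartEndo p J y u))) := rfl
  rw [h2, h1, hJ, map_neg, toChart_fromChart hy]

/-- Only the values of `X` and `Y` at `p` matter, so arbitrary fields may be tested on the frame `k,
t, x, y`. -/
theorem nijenhuis_eq_flatNijenhuis {J : (p : M) → Tan p →L[ℝ] Tan p}
    (hJ : ∀ q (v : Tan q), J q (J q v) = -v) {X Y : VField M} {p : M}
    (hJs : ContDiffAt ℝ ∞ (chartEndo p J) (extChartAt (𝓡 4) p p))
    (hX : SmoothFieldAt X p) (hY : SmoothFieldAt Y p) :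
    nijenhuis J X Y p = flatNijenhuis (chartEndo p J) (extChartAt (𝓡 4) p p) (X p) (Y p) := by
  have key := lieBracket_eq_flatNijenhuis (hJs.differentiableAt (by simp))
    ((contDiffAt_chartField hX).differentiableAt (by simp))
    ((contDiffAt_chartField hY).differentiableAt (by simp))
    (chartEndo_sq hJ (mem_extChartAt_target (I := 𝓡 4) p))
  have eX := eventually_chartEndo_chartField J X p
  have eY := eventually_chartEndo_chartField J Y p
  have hR : ∀ V W : VField M, ∀ V' W' : R4 → R4, chartField p V =ᶠ[𝓝 (extChartAt (𝓡 4) p p)] V' →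
      chartField p W =ᶠ[𝓝 (extChartAt (𝓡 4) p p)] W' →
      mlieBracket (𝓡 4) V W p = lieBracket ℝ V' W' (extChartAt (𝓡 4) p p) := fun V W V' W' h1 h2 =>
    (mlieBracket_eq V W p).trans (h1.lieBracket_vectorField_eq h2)
  have hC : ∀ v : Tan p, J p v = chartEndo p J (extChartAt (𝓡 4) p p) v := fun v =>
    (chartEndo_self J p v).symm
  rw [chartField_self p X, chartField_self p Y] at key
  refine Eq.trans ?_ key
  unfold nijenhuis
  rw [hC, hC, hR _ _ _ _ eX eY, hR _ _ _ _ eX .rfl, hR _ _ _ _ .rfl eY, hR _ _ _ _ .rfl .rfl]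
  rfl

namespace SemiRiemannianMetric

theorem IsAdmissible.nijenhuis_eq_zero [T2Space M] (hadm : g.IsAdmissible o k t τ ℓ)
    {X Y : VField M} {p : M} (hX : SmoothFieldAt X p) (hY : SmoothFieldAt Y p) :
    nijenhuis (g.acs o k t) X Y p = 0 := by
  have hsq : ∀ q (v : Tan q), g.acs o k t q (g.acs o k t q v) = -v := fun q v => hadm.acs_sq v
  have sJ := hadm.contDiffAt_acs p
  have sk := hadm.smooth_k.smoothFieldAt (p := p) univ_mem
  obtain ⟨e, e', he, he', heh, heh', hfr⟩ := hadm.exists_frame p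
  have se := he.smoothFieldAt (p := p) univ_mem
  have se' := he'.smoothFieldAt (p := p) univ_mem
  have h := hfr.self_of_nhds
  have htar := eventually_target p
  have hfr' := (tendsto_chart_symm p).eventually hfr
  have hz := mem_extChartAt_target (I := 𝓡 4) p
  have hJe : ∀ᶠ y in 𝓝 (extChartAt (𝓡 4) p p),
      chartEndo p (g.acs o k t) y (chartField p e y) = chartField p e' y := by
    filter_upwards [htar, hfr'] with y hy h1
    rw [chartEndo_chartField _ _ hy, chartField_eq _ hy, chartField_eq _ hy, (hadm.acs_frame h1).1]
  have hJk : ∀ᶠ y in 𝓝 (extChartAt (𝓡 4) p p),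
      chartEndo p (g.acs o k t) y (chartField p k y) = chartField p t y := by
    filter_upwards [htar] with y hy
    rw [chartEndo_chartField _ _ hy, chartField_eq _ hy, chartField_eq _ hy,
      (hadm.isJAt_acs _).map_k]
  -- A horizontal bracket is a combination of the two frame vectors; the brackets of `k` and `t`
  -- with the frame are horizontal by admissibility.
  have hbr : ∀ V W : VField M, mlieBracket (𝓡 4) V W p ∈ g.horiz k t p → ∃ a b : ℝ,
      lieBracket ℝ (chartField p V) (chartField p W) (extChartAt (𝓡 4) p p) =
        a • chartField p e (extChartAt (𝓡 4) p p) +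
          b • chartField p e' (extChartAt (𝓡 4) p p) := fun V W hm => by
    refine ⟨g.val p (mlieBracket (𝓡 4) V W p) (e p), g.val p (mlieBracket (𝓡 4) V W p) (e' p),
      (mlieBracket_eq V W p).symm.trans ?_⟩
    rw [chartField_self p e, chartField_self p e']
    exact hadm.horiz_expand h hm
  have hnab : ∀ V X Y : VField M, g.inChart p (extChartAt (𝓡 4) p p)
      (flatNabla (g.inChart p) (chartField p V) (extChartAt (𝓡 4) p p)
        (chartField p X (extChartAt (𝓡 4) p p))) (chartField p Y (extChartAt (𝓡 4) p p)) =
      g.val p (g.nabla V p (X p)) (Y p) := fun V X Y => by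
    rw [chartField_self p X, chartField_self p Y, nabla_apply]
    exact g.inChart_self p _ _
  obtain ⟨n1, n2⟩ := hadm.nabla_frame h
  have hN := flatNijenhuis_frame (g := g.inChart p) (J := chartEndo p (g.acs o k t))
    (k := chartField p k) (t := chartField p t) (x := chartField p e) (y := chartField p e')
    ((g.contDiffAt_inChart p).differentiableAt (by simp))
    (.of_forall fun y => g.inChart_symm p y) (g.isInvertible_inChart p)
    (sJ.differentiableAt (by simp))
    ((contDiffAt_chartField sk).differentiableAt (by simp))
    ((contDiffAt_chartField se).differentiableAt (by simp))
    ((contDiffAt_chartField se').differentiableAt (by simp))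
    (chartEndo_sq hsq hz) hJk hJe
    (by filter_upwards [htar, hfr'] with y hy h1
        exact (g.inChart_chartField e e hy).trans h1.2.2.1)
    (by filter_upwards [htar, hfr'] with y hy h1
        exact (g.inChart_chartField e' e' hy).trans h1.2.2.2.1)
    (by filter_upwards [htar, hfr'] with y hy h1
        exact (g.inChart_chartField e e' hy).trans h1.2.2.2.2.1)
    (hbr k e (hadm.bracket_k e he heh p)) (hbr k e' (hadm.bracket_k e' he' heh' p))
    (hbr t e (hadm.bracket_t e he heh p)) (hbr t e' (hadm.bracket_t e' he' heh' p))
    (by rw [hnab, hnab, hnab, hnab]; exact n1) (by rw [hnab, hnab, hnab, hnab]; exact n2)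
  rw [nijenhuis_eq_flatNijenhuis hsq sJ hX hY]
  refine flatNijenhuis_eq_zero (sJ.differentiableAt (by simp))
    (by filter_upwards [htar] with y hy using chartEndo_sq hsq hy) (fun u => ?_) hN _ _
  rw [hJk.self_of_nhds, hJe.self_of_nhds, chartField_self p k, chartField_self p t,
    chartField_self p e, chartField_self p e']
  exact ⟨_, _, _, _, hadm.expand h u⟩

end SemiRiemannianMetric

end Integrability

/-! ### Assembly of the Kähler structure. -/

theorem mainTheorem1 {M : Type*} [TopologicalSpace M] [T2Space M] [ChartedSpace R4 M]
    [IsManifold (𝓡 4) ∞ M] (g : SemiRiemannianMetric M) (o : MOrientation M)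
    (k t : VField M) (τ ℓ : M → ℝ) (hadm : g.IsAdmissible o k t τ ℓ)
    (f : ℝ → ℝ) (hf : ContDiffOn ℝ ∞ f (Set.range τ)) :
    (∀ p : M, ∀ u v : Tan p,
      g.omega k τ f p ![g.acs o k t p u, g.acs o k t p v] = g.omega k τ f p ![u, v]) ∧
    IsKahlerOn (g.gK o k t τ f) (g.acs o k t) (g.omega k τ f) (g.region o k t τ ℓ f) := by
  have sk : ∀ p, SmoothFieldAt k p := fun p => hadm.smooth_k.smoothFieldAt univ_mem
  have sf : ∀ p, ContMDiffAt (𝓡 4) 𝓘(ℝ, ℝ) ∞ (fun q => f (τ q)) p := fun p =>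
    (hf.contDiffAt (hadm.range_mem_nhds p)).contMDiffAt.comp p (hadm.smooth_τ p)
  -- Invariance holds on all of `M`; symmetry, the Hermitian property and the formula for the Kähler
  -- form all rest on it.
  have hinv : ∀ p : M, ∀ u v : Tan p,
      g.omega k τ f p ![g.acs o k t p u, g.acs o k t p v] = g.omega k τ f p ![u, v] := by
    intro p u v
    obtain ⟨X, Y, hX, hY, hXh, hYh, hXY⟩ := hadm.exists_frame p
    have h := hXY.self_of_nhds
    obtain ⟨z1, z2⟩ := hadm.omega_horiz hf hX hXh p
    obtain ⟨z3, z4⟩ := hadm.omega_horiz hf hY hYh p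
    exact twoForm_apply_map_map (E := R4) (η := g.omega k τ f p) z1 z3 z2 z4
      (hadm.isJAt_acs p).map_k (hadm.isJAt_acs p).map_t (hadm.acs_frame h).1 (hadm.acs_frame h).2
      (fun u => ⟨_, _, _, _, hadm.expand h u⟩) u v
  refine ⟨hinv, hadm.isOpen_region hf, ?_, ?_, ?_, ?_, fun _ _ u => hadm.acs_sq u, ?_, ?_, ?_, ?_⟩
  · intro p _
    exact (contMDiffAt_bilin_iff.mpr
      (g.contDiffAt_twisted (sf p) (sk p) (hadm.contDiffAt_acs p))).contMDiffWithinAt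
  · intro p _ u v
    rw [g.gK_apply, g.gK_apply]
    exact twoForm_apply_map_symm (E := R4) (hinv p) hadm.acs_sq u v
  · intro p hp u hu
    obtain ⟨X, Y, hX, hY, hXh, hYh, hXY⟩ := hadm.exists_frame p
    have h := hXY.self_of_nhds
    obtain ⟨z1, z2⟩ := hadm.omega_horiz hf hX hXh p
    obtain ⟨z3, z4⟩ := hadm.omega_horiz hf hY hYh p
    obtain ⟨p1, p2⟩ := (hadm.mem_region_iff hf h).mp hp
    rw [g.gK_apply]
    exact twoForm_apply_map_pos (E := R4) (η := g.omega k τ f p) z1 z3 z2 z4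
      (hadm.isJAt_acs p).map_k (hadm.isJAt_acs p).map_t (hadm.acs_frame h).1 (hadm.acs_frame h).2
      (fun u => ⟨_, _, _, _, hadm.expand h u⟩) p2 p1 hu
  · intro p _
    exact (contMDiffAt_endo_iff.mpr (hadm.contDiffAt_acs p)).contMDiffWithinAt
  · intro X Y hX hY p hp
    have hU := (hadm.isOpen_region hf).mem_nhds hp
    exact hadm.nijenhuis_eq_zero (hX.smoothFieldAt hU) (hY.smoothFieldAt hU)
  · intro p _ u v
    rw [g.gK_apply, g.gK_apply, hinv]
  · intro p _ u v
    rw [g.gK_apply, hinv]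
  · intro p _
    exact mextDeriv_mextDeriv _ (g.contDiffAt_chartForm_flatForm (sf p) (sk p))
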